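/- Let $(\Omega,\mathcal F,\mathbf P)$ be a complete probability space, let $\mathcal H\subseteq\mathcal F$ be a sub-$\sigma$-algebra, and let $\mathbb X$ be a separable real Banach space with its Borel $\sigma$-algebra $\mathcal B(\mathbb X)$ and dual space $\mathbb X^*$. For a sub-$\sigma$-algebra $\mathcal G\subseteq\mathcal F$, a $\mathcal G$-measurable random closed set is a map $Z$ from $\Omega$ to the subsets of $\mathbb X$ such that $\{(\omega,x):x\in Z(\omega)\}\in\mathcal G\otimes\mathcal B(\mathbb X)$ and $Z(\omega)$ is closed for almost all $\omega$; $L^0(Z,\mathcal G)$ is the family of $\mathcal G$-measurable random elements $\xi$ of $\mathbb X$ with $\xi\in Z$ a.s. The support function of $A\subseteq\mathbb X$ is $h_A(u)=\sup\{\langle u,x\rangle:x\in A\}$, $u\in\mathbb X^*$, with $h_\emptyset=-\infty$. A map $\zeta:\Omega\to\mathbb X^*$ is an $\mathcal H$-measurable random element of $\mathbb X^*$ if $\langle\zeta,x\rangle$ is an $\mathcal H$-measurable random variable for each $x\in\mathbb X$. An $\mathcal F$-measurable random element $\xi$ of $\mathbb X$ is called $\mathcal H$-conditionally integrable if there is a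 countable partition $\{A_i,\,i\ge1\}$ of $\Omega$ into $\mathcal H$-measurable sets such that $\xi 1_{A_i}$ is integrable for all $i$; then $\mathbf E^g(\xi|\mathcal H)=\sum_i\mathbf E(\xi1_{A_i}|\mathcal H)1_{A_i}$, which up to null sets does not depend on the partition. For a random variable $\eta$ with values in $[-\infty,\infty]$ such that $\mathbf E(\eta^-|\mathcal H)<\infty$ a.s., let $\mathbf E^g(\eta|\mathcal H)=\mathbf E(\eta^+|\mathcal H)-\mathbf E(\eta^-|\mathcal H)\in(-\infty,\infty]$. Let $X$ be an $\mathcal F$-measurable random closed set in $\mathbb X$, and let $L^{1_{\mathcal H}}(X,\mathcal F)$ be the family of the $\xi\in L^0(X,\mathcal F)$ that are $\mathcal H$-conditionally integrable. Assume that $L^{1_{\mathcal H}}(X,\mathcal F)\neq\emptyset$. Then the generalised conditional expectation $\mathbf E^g(X|\mathcal H)$ exists, that is, there is an $\mathcal H$-measurable random closed set $\mathbf E^g(X|\mathcal H)$ such that $$L^0(\mathbf E^g(X|\mathcal H),\mathcal H)=\mathrm{cl}_0\{\mathbf E^g(\xi|\mathcal H):\ \xi\in L^{1_{\mathcal H}}(X,\mathcal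 F)\},$$ where $\mathrm{cl}_0$ is the closure with respect to convergence in probability. Moreover, for every such set (every version of $\mathbf E^g(X|\mathcal H)$) and every $\mathcal H$-measurable random element $\zeta$ of $\mathbb X^*$, $h_X(\zeta)$ is a random variable with values in $[-\infty,\infty]$ and $\mathbf E(h_X(\zeta)^-|\mathcal H)<\infty$ a.s., and $$\mathbf E^g(h_X(\zeta)|\mathcal H)=h_{\mathbf E^g(X|\mathcal H)}(\zeta)\quad\text{a.s.}$$ -/

import Mathlib

open MeasureTheory Filter

noncomputable section

namespace RandomSets

variable {Ω 𝕏 : Type*}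

/-- `X` is an `H`-measurable random closed set: its graph belongs to `H ⊗ 𝓑(𝕏)`, and almost all of
its values are closed. -/
structure IsRandomClosedSet [TopologicalSpace 𝕏] [MeasurableSpace 𝕏] (H : MeasurableSpace Ω)
    {mF : MeasurableSpace Ω} (P : Measure[mF] Ω) (X : Ω → Set 𝕏) : Prop where
  measurableSet_graph : MeasurableSet[H.prod inferInstance] {p : Ω × 𝕏 | p.2 ∈ X p.1}
  ae_isClosed : ∀ᵐ ω ∂P, IsClosed (X ω)

/-- The family `L⁰(X, H)` of `H`-measurable selections of `X`. -/
def selections [MeasurableSpace 𝕏] (H : MeasurableSpace Ω) {mF : MeasurableSpace Ω}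
    (P : Measure[mF] Ω) (X : Ω → Set 𝕏) : Set (Ω → 𝕏) :=
  {ξ | Measurable[H] ξ ∧ ∀ᵐ ω ∂P, ξ ω ∈ X ω}

/-- `(A i)` is a countable partition of `Ω` into `H`-measurable sets (some may be empty). -/
def IsMeasurablePartition (H : MeasurableSpace Ω) (A : ℕ → Set Ω) : Prop :=
  (∀ i, MeasurableSet[H] (A i)) ∧ Pairwise (Function.onFun Disjoint A) ∧ ⋃ i, A i = Set.univ

/-- `ξ 1_{A i}` is integrable for all `i`. -/
def IntegrableOnPieces [NormedAddCommGroup 𝕏] {mF : MeasurableSpace Ω} (P : Measure[mF] Ω)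
    (ξ : Ω → 𝕏) (A : ℕ → Set Ω) : Prop :=
  ∀ i, Integrable ((A i).indicator ξ) P

/-- `ξ ∈ L^{1_H}(𝕏, F)`: the random element `ξ` is `H`-conditionally integrable. -/
def CondIntegrable [NormedAddCommGroup 𝕏] [MeasurableSpace 𝕏] (H : MeasurableSpace Ω)
    {mF : MeasurableSpace Ω} (P : Measure[mF] Ω) (ξ : Ω → 𝕏) : Prop :=
  Measurable[mF] ξ ∧ ∃ A : ℕ → Set Ω, IsMeasurablePartition H A ∧ IntegrableOnPieces P ξ A

open scoped Classical in
/-- The generalised conditional expectation `∑ᵢ E(ξ 1_{A i} | H) 1_{A i}` of an `H`-conditionally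
integrable random element `ξ` (up to null sets it does not depend on the partition). The value for
other `ξ` is irrelevant. -/
def genCondExp [NormedAddCommGroup 𝕏] [NormedSpace ℝ 𝕏] [CompleteSpace 𝕏] [MeasurableSpace 𝕏]
    (H : MeasurableSpace Ω) {mF : MeasurableSpace Ω} (P : Measure[mF] Ω) (ξ : Ω → 𝕏) : Ω → 𝕏 :=
  if h : CondIntegrable H P ξ then
    fun ω => ∑' i, (h.2.choose i).indicator (P[(h.2.choose i).indicator ξ|H]) ω
  else 0

/-- `L^{1_H}(X, F)`: the selections of `X` that are `H`-conditionally integrable. -/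
def condIntegrableSelections [NormedAddCommGroup 𝕏] [MeasurableSpace 𝕏] (H : MeasurableSpace Ω)
    {mF : MeasurableSpace Ω} (P : Measure[mF] Ω) (X : Ω → Set 𝕏) : Set (Ω → 𝕏) :=
  {ξ | ξ ∈ selections mF P X ∧ CondIntegrable H P ξ}

/-- The closure of `Ξ` in `L⁰(𝕏, H)` with respect to convergence in probability (a metrisable
convergence, so that limits of sequences suffice). -/
def closureL0 [NormedAddCommGroup 𝕏] [MeasurableSpace 𝕏] (H : MeasurableSpace Ω)
    {mF : MeasurableSpace Ω} (P : Measure[mF] Ω) (Ξ : Set (Ω → 𝕏)) : Set (Ω → 𝕏) :=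
  {η | Measurable[H] η ∧
    ∃ s : ℕ → Ω → 𝕏, (∀ n, s n ∈ Ξ) ∧ TendstoInMeasure P s atTop η}

/-- `Y` is (a version of) the generalised conditional expectation of the random closed set `X`
given `H`: the `H`-measurable random closed set whose `H`-measurable selections form the
`L⁰`-closure of the generalised conditional expectations of `L^{1_H}(X, F)`. -/
structure IsGenCondExpSet [NormedAddCommGroup 𝕏] [NormedSpace ℝ 𝕏] [CompleteSpace 𝕏]
    [MeasurableSpace 𝕏] (H : MeasurableSpace Ω) {mF : MeasurableSpace Ω} (P : Measure[mF] Ω)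
    (X Y : Ω → Set 𝕏) : Prop where
  isRandomClosedSet : IsRandomClosedSet H P Y
  selections_eq :
    selections H P Y = closureL0 H P (genCondExp H P '' condIntegrableSelections H P X)

/-- The support function `h_A(u) = sup {⟨u, x⟩ : x ∈ A}`, with value `-∞` for empty `A`. -/
def supportFun [NormedAddCommGroup 𝕏] [NormedSpace ℝ 𝕏] (A : Set 𝕏) (u : StrongDual ℝ 𝕏) : EReal :=
  ⨆ x ∈ A, ((u x : ℝ) : EReal)

/-- `ζ ∈ L⁰(𝕏*, H)`: measurability for the Borel σ-algebra of the weak-star topology, that is,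
`⟨ζ, x⟩` is an `H`-measurable random variable for each `x`. -/
def IsRandomDual [NormedAddCommGroup 𝕏] [NormedSpace ℝ 𝕏] (H : MeasurableSpace Ω)
    (ζ : Ω → StrongDual ℝ 𝕏) : Prop :=
  ∀ x : 𝕏, Measurable[H] fun ω => ζ ω x

/-- `f` is an extended random variable whose generalised conditional expectation is defined with
values in `(-∞, ∞]`: the conditional expectation of its negative part is a.s. finite. -/
def HasGenCondExpE (H : MeasurableSpace Ω) {mF : MeasurableSpace Ω} (P : Measure[mF] Ω)
    (f : Ω → EReal) : Prop :=
  Measurable[mF] f ∧ ∀ᵐ ω ∂P, (P⁻[fun ω' => (-f ω').toENNReal|H]) ω < ⊤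

/-- The generalised conditional expectation `E(f⁺ | H) - E(f⁻ | H)` of an extended random variable
`f`, where `f⁺ = f ∨ 0` and `f⁻ = (-f) ∨ 0`. -/
def genCondExpE (H : MeasurableSpace Ω) {mF : MeasurableSpace Ω} (P : Measure[mF] Ω)
    (f : Ω → EReal) : Ω → EReal :=
  fun ω => ((P⁻[fun ω' => (f ω').toENNReal|H]) ω : EReal)
    - ((P⁻[fun ω' => (-f ω').toENNReal|H]) ω : EReal)

end RandomSets

end

namespace RandomSets

open Topology ENNReal

/-! ### Measurable projections -/

/-! Existence rests on locality. Gluing conditionally integrable selections of `X` along an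
`H`-partition also glues their conditional expectations, so these expectations form a decomposable
family (`isDecomposable_genCondExp_image`). Such a family contains a sequence whose pointwise
closure almost surely contains each given member (`IsDecomposable.exists_countable_dense`). That
closure is a random closed set, and its selections are exactly the `L⁰`-closure of the family.

For the identity, write `Y` for the conditional expectation of `X`. Pulling `ζ` out of the
expectation turns E(⟨ζ, ξ⟩ | H) into ⟨ζ, E(ξ | H)⟩ (`exists_partition_condExp_dual_apply`). Each
selection satisfies ⟨ζ, ξ⟩ ≤ h_X(ζ), hence ⟨ζ, E(ξ | H)⟩ ≤ E(h_X(ζ) | H). Limits in probability and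
a dense sequence of selections of `Y` then give h_Y(ζ) ≤ E(h_X(ζ) | H). Conversely, `X` has a dense
sequence of conditionally integrable selections (`exists_condIntegrableSelections_dense`). Its
running maximisers χ_n are again such selections and ⟨ζ, χ_n⟩ increases to h_X(ζ). Monotone
convergence (`genCondExpE_le_of_iSup`) bounds E(h_X(ζ) | H) by h_Y(ζ), because every E(χ_n | H) is a
selection of `Y`.

Both dense sequences of selections come from `exists_castaing`. It relies on the measurable
projection theorem, which makes the events that a random set hits a ball measurable up to null sets.
-/

theorem exists_isCompact_subset_range_le_measure {Y : Type*} [MetricSpace Y] [MeasurableSpace Y]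
    [BorelSpace Y] (μ : Measure Y) [IsFiniteMeasure μ] {f : (ℕ → ℕ) → Y} (hf : Continuous f)
    {c : ℝ≥0∞} (hc : c < μ (Set.range f)) :
    ∃ K : Set Y, IsCompact K ∧ K ⊆ Set.range f ∧ c ≤ μ K := by
  -- One coordinate at a time is bounded while the image keeps measure above `c`. Continuity from
  -- below holds for outer measures of arbitrary sets, so the images need not be measurable.
  have step : ∀ (k : ℕ) (S : {S : Set (ℕ → ℕ) // c < μ (f '' S)}),
      ∃ n : ℕ, c < μ (f '' (S.1 ∩ {x | x k ≤ n})) := by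
    intro k S
    have hmono : Monotone fun n : ℕ => f '' (S.1 ∩ {x | x k ≤ n}) := by
      intro a b hab
      exact Set.image_mono fun x hx => ⟨hx.1, le_trans hx.2 hab⟩
    have hU : f '' S.1 = ⋃ n : ℕ, f '' (S.1 ∩ {x | x k ≤ n}) := by
      rw [← Set.image_iUnion, ← Set.inter_iUnion]
      congr 1
      ext x
      simp only [Set.mem_inter_iff, Set.mem_iUnion, Set.mem_ofPred_eq]
      exact ⟨fun h => ⟨h, x k, le_rfl⟩, fun h => h.1⟩
    have := S.2
    rw [hU, hmono.measure_iUnion] at this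
    exact lt_iSup_iff.1 this
  choose N hN using step
  let S : ℕ → {S : Set (ℕ → ℕ) // c < μ (f '' S)} := fun k =>
    Nat.rec ⟨Set.univ, by rwa [Set.image_univ]⟩ (fun k S => ⟨S.1 ∩ {x | x k ≤ N k S}, hN k S⟩) k
  let n : ℕ → ℕ := fun k => N k (S k)
  have hS : ∀ k, (S (k + 1)).1 = (S k).1 ∩ {x | x k ≤ n k} := fun k => rfl
  have hanti : Antitone fun k => (S k).1 :=
    antitone_nat_of_succ_le fun k => by rw [hS]; exact Set.inter_subset_left
  have hle : ∀ k, ∀ x ∈ (S k).1, ∀ i < k, x i ≤ n i := by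
    intro k x hx i hi
    have : x ∈ (S (i + 1)).1 := hanti hi hx
    rw [hS] at this
    exact this.2
  let C : Set (ℕ → ℕ) := Set.pi Set.univ fun i => Set.Iic (n i)
  have hC : IsCompact C := isCompact_univ_pi fun i => (Set.finite_Iic (n i)).isCompact
  have hsub : ⋂ k, closure (f '' (S k).1) ⊆ f '' C := by
    intro y hy
    have hx : ∀ k : ℕ, ∃ x ∈ (S k).1, dist y (f x) < 1 / ((k : ℝ) + 1) := by
      intro k
      have := Metric.mem_closure_iff.1 (Set.mem_iInter.1 hy k) (1 / ((k : ℝ) + 1)) (by positivity)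
      obtain ⟨_, ⟨x, hx, rfl⟩, h⟩ := this
      exact ⟨x, hx, h⟩
    choose x hxS hxd using hx
    -- The points `x k` need not lie in the box `C`, so they are truncated to it before compactness
    -- is used. Each fixed coordinate is eventually unaffected by the truncation.
    obtain ⟨z, hz, φ, hφ, hlim⟩ :=
      hC.tendsto_subseq (x := fun k i => min (x k i) (n i)) fun k i _ => Set.mem_Iic.2 (min_le_right _ _)
    have hxz : Tendsto (x ∘ φ) atTop (𝓝 z) := by
      rw [tendsto_pi_nhds] at hlim ⊢
      intro i
      refine (hlim i).congr' ?_
      filter_upwards [eventually_gt_atTop i] with j hj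
      exact min_eq_left (hle _ _ (hxS (φ j)) i (hj.trans_le (hφ.id_le j)))
    have h1 : Tendsto (fun j => f (x (φ j))) atTop (𝓝 (f z)) := (hf.tendsto z).comp hxz
    have h2 : Tendsto (fun k => f (x k)) atTop (𝓝 y) := by
      rw [tendsto_iff_dist_tendsto_zero]
      refine squeeze_zero (fun _ => dist_nonneg) (fun k => ?_)
        (tendsto_one_div_add_atTop_nhds_zero_nat (𝕜 := ℝ))
      rw [dist_comm]
      exact (hxd k).le
    exact ⟨z, hz, tendsto_nhds_unique h1 (h2.comp hφ.tendsto_atTop)⟩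
  refine ⟨f '' C, hC.image hf, Set.image_subset_range _ _, le_trans ?_ (measure_mono hsub)⟩
  have hanti' : Antitone fun k => closure (f '' (S k).1) := fun a b hab =>
    closure_mono (Set.image_mono (hanti hab))
  rw [hanti'.measure_iInter (fun k => isClosed_closure.measurableSet.nullMeasurableSet)
    ⟨0, measure_ne_top _ _⟩]
  exact le_iInf fun k => (S k).2.le.trans (measure_mono subset_closure)

/-- Countably many compact subsets exhaust the measure of an analytic set, so it differs from a
σ-compact set by a null set. -/
theorem nullMeasurableSet_of_analyticSet {Y : Type*} [MetricSpace Y] [MeasurableSpace Y]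
    [BorelSpace Y] (μ : Measure Y) [IsFiniteMeasure μ] {A : Set Y} (hA : AnalyticSet A) :
    NullMeasurableSet A μ := by
  rw [AnalyticSet] at hA
  rcases hA with rfl | ⟨f, hf, rfl⟩
  · exact MeasurableSet.empty.nullMeasurableSet
  by_cases h0 : μ (Set.range f) = 0
  · exact NullMeasurableSet.of_null h0
  obtain ⟨u, -, hu, hlim⟩ := exists_seq_strictMono_tendsto' (bot_lt_iff_ne_bot.2 h0)
  choose K hK hKsub hKμ using
    fun n => exists_isCompact_subset_range_le_measure μ hf (hu n).2
  have hsub : ⋃ n, K n ⊆ Set.range f := Set.iUnion_subset hKsub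
  have hmeas : NullMeasurableSet (⋃ n, K n) μ :=
    (MeasurableSet.iUnion fun n => (hK n).isClosed.measurableSet).nullMeasurableSet
  refine hmeas.congr (ae_eq_of_subset_of_measure_ge hsub ?_ hmeas (measure_ne_top _ _))
  exact le_of_tendsto' hlim fun n => (hKμ n).trans (measure_mono (Set.subset_iUnion K n))

/-- A set in a product σ-algebra involves only countably many measurable subsets of `Ω`, and these
are coded by one map into the Cantor space. This reduces projection from an arbitrary `Ω` to
projection between Polish spaces. -/
theorem exists_measurable_cantor_preimage_eq {Ω 𝕏 : Type*} [MeasurableSpace Ω] [MeasurableSpace 𝕏]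
    {G : Set (Ω × 𝕏)} (hG : MeasurableSet G) :
    ∃ (φ : Ω → ℕ → Bool) (G' : Set ((ℕ → Bool) × 𝕏)), Measurable φ ∧ MeasurableSet G' ∧
      G = Prod.map φ id ⁻¹' G' := by
  classical
  rw [show (Prod.instMeasurableSpace : MeasurableSpace (Ω × 𝕏)) = _ from
    generateFrom_prod.symm] at hG
  induction G, hG using MeasurableSpace.generateFrom_induction with
  | hC t ht _ =>
    obtain ⟨A, hA, B, hB, rfl⟩ := ht
    refine ⟨fun ω _ => decide (ω ∈ A), {y | y 0 = true} ×ˢ B, ?_, ?_, ?_⟩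
    · exact measurable_pi_lambda _ fun _ => measurable_to_bool (by simpa [Set.preimage] using hA)
    · exact (measurableSet_eq_fun (measurable_pi_apply 0) measurable_const).prod hB
    · ext ⟨ω, x⟩
      simp
  | empty => exact ⟨fun _ _ => true, ∅, measurable_const, MeasurableSet.empty, by simp⟩
  | compl t _ ih =>
    obtain ⟨φ, G', hφ, hG', rfl⟩ := ih
    exact ⟨φ, G'ᶜ, hφ, hG'.compl, rfl⟩
  | iUnion s _ ih =>
    choose φ G' hφ hG' h using ih
    -- The codes of the countably many sets are interleaved into a single binary sequence by the
    -- pairing function.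
    refine ⟨fun ω n => φ n.unpair.1 ω n.unpair.2,
      ⋃ i, Prod.map (fun y n => y (Nat.pair i n)) id ⁻¹' G' i, ?_, ?_, ?_⟩
    · exact measurable_pi_lambda _ fun n => (measurable_pi_apply _).comp (hφ _)
    · refine MeasurableSet.iUnion fun i => ?_
      refine Measurable.prodMap ?_ measurable_id (hG' i)
      exact measurable_pi_lambda _ fun n => measurable_pi_apply _
    · rw [Set.preimage_iUnion]
      refine Set.iUnion_congr fun i => ?_
      rw [h i]
      ext ⟨ω, x⟩
      simp

/-- The measurable projection theorem. -/
theorem nullMeasurableSet_exists_mem {Ω 𝕏 : Type*} [MeasurableSpace Ω] (μ : Measure Ω)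
    [IsFiniteMeasure μ] [TopologicalSpace 𝕏] [PolishSpace 𝕏] [MeasurableSpace 𝕏] [BorelSpace 𝕏]
    {G : Set (Ω × 𝕏)} (hG : MeasurableSet G) : NullMeasurableSet {ω | ∃ x, (ω, x) ∈ G} μ := by
  obtain ⟨φ, G', hφ, hG', rfl⟩ := exists_measurable_cantor_preimage_eq hG
  let := TopologicalSpace.upgradeIsCompletelyMetrizable (ℕ → Bool)
  have hA : AnalyticSet (Prod.fst '' G') := hG'.analyticSet.image_of_continuous continuous_fst
  have := (nullMeasurableSet_of_analyticSet (μ.map φ) hA).preimage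
    (hφ.quasiMeasurePreserving μ)
  convert this using 1
  ext ω
  simp

/-! ### Castaing representations -/

theorem measurable_sInf_nat {Ω : Type*} [MeasurableSpace Ω] {p : ℕ → Ω → Prop}
    (hp : ∀ k, MeasurableSet {ω | p k ω}) : Measurable fun ω => sInf {k | p k ω} := by
  classical
  refine measurable_to_countable' fun n => ?_
  -- Since `sInf ∅ = 0`, the fibre over `0` also contains the points where no index qualifies.
  have : (fun ω => sInf {k | p k ω}) ⁻¹' {n} =
      ({ω | p n ω} ∩ ⋂ k ∈ Set.Iio n, {ω | p k ω}ᶜ) ∪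
        (if n = 0 then ⋂ k, {ω | p k ω}ᶜ else ∅) := by
    ext ω
    simp only [Set.mem_preimage, Set.mem_singleton_iff, Set.mem_union, Set.mem_inter_iff,
      Set.mem_ofPred_eq, Set.mem_iInter, Set.mem_Iio, Set.mem_compl_iff]
    constructor
    · intro h
      by_cases hne : ∃ k, p k ω
      · left
        have hmem : sInf {k | p k ω} ∈ {k | p k ω} := Nat.sInf_mem hne
        rw [h] at hmem
        exact ⟨hmem, fun k hk hpk => absurd (Nat.sInf_le (s := {k | p k ω}) hpk) (by omega)⟩
      · right
        push Not at hne
        have h0 : {k | p k ω} = ∅ := Set.eq_empty_of_forall_notMem hne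
        rw [h0, Nat.sInf_empty] at h
        rw [if_pos h.symm]
        simpa using hne
    · rintro (⟨h1, h2⟩ | h)
      · refine le_antisymm (Nat.sInf_le h1) ?_
        by_contra hlt
        push Not at hlt
        exact h2 _ hlt (Nat.sInf_mem (s := {k | p k ω}) ⟨n, h1⟩)
      · split_ifs at h with hn
        · have h0 : {k | p k ω} = ∅ :=
            Set.eq_empty_of_forall_notMem fun k hk => Set.mem_iInter.1 h k hk
          rw [h0, Nat.sInf_empty, hn]
        · exact absurd h (Set.notMem_empty _)
  rw [this]
  refine ((hp n).inter (MeasurableSet.biInter (Set.to_countable _)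
    fun k _ => (hp k).compl)).union ?_
  split_ifs
  · exact MeasurableSet.iInter fun k => (hp k).compl
  · exact MeasurableSet.empty

section

variable {Ω 𝕏 : Type*} [MeasurableSpace Ω] [MetricSpace 𝕏] [CompleteSpace 𝕏] [MeasurableSpace 𝕏]
  [BorelSpace 𝕏]

/-- Starting from a dense point near `Γ ω`, the least admissible index is chosen at each step so
that the distance to `Γ ω` halves. The chosen points form a geometric Cauchy sequence whose limit
lies in the closure. The sets `T k j` are measurable substitutes for the hitting events, with which
they agree only almost surely. -/
theorem exists_measurable_selection_closure_of_start (μ : Measure Ω) {Γ : Ω → Set 𝕏} {x : ℕ → 𝕏}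
    (hx : DenseRange x) {T : ℕ → ℕ → Set Ω} (hT : ∀ k j, MeasurableSet (T k j))
    (hTΓ : ∀ᵐ ω ∂μ, ∀ k j, ω ∈ T k j ↔ ∃ y ∈ Γ ω, dist y (x k) < (1 / 2 : ℝ) ^ j) (j₀ : ℕ)
    {κ₀ : Ω → ℕ} (hκ₀ : Measurable κ₀) (hκT : ∀ᵐ ω ∂μ, ω ∈ T (κ₀ ω) j₀) :
    ∃ σ : Ω → 𝕏, Measurable σ ∧
      ∀ᵐ ω ∂μ, σ ω ∈ closure (Γ ω) ∧ dist (x (κ₀ ω)) (σ ω) ≤ 4 * (1 / 2 : ℝ) ^ j₀ := by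
  -- The factor 2 leaves room for a point of `Γ ω` within `2⁻ʲ` of the current dense point and a new
  -- dense point within half that distance of it. The resulting geometric series sums to `4 * 2⁻ʲ`
  -- at `j = j₀`.
  let p : ℕ → (Ω → ℕ) → ℕ → Ω → Prop := fun i κ k ω =>
    ω ∈ T k (j₀ + i + 1) ∧ dist (x k) (x (κ ω)) < 2 * (1 / 2 : ℝ) ^ (j₀ + i)
  let κ : ℕ → Ω → ℕ := fun i => Nat.rec κ₀ (fun i κ ω => sInf {k | p i κ k ω}) i
  have hκ_succ : ∀ i ω, κ (i + 1) ω = sInf {k | p i (κ i) k ω} := fun i ω => rfl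
  have hκ : ∀ i, Measurable (κ i) := by
    intro i
    induction i with
    | zero => exact hκ₀
    | succ i ih =>
      refine measurable_sInf_nat fun k => (hT k _).inter ?_
      exact measurableSet_lt
        ((measurable_from_top (f := fun n : ℕ => dist (x k) (x n))).comp ih) measurable_const
  have hgood : ∀ᵐ ω ∂μ, ∀ i, ω ∈ T (κ i ω) (j₀ + i) ∧
      dist (x (κ i ω)) (x (κ (i + 1) ω)) ≤ 2 * (1 / 2 : ℝ) ^ j₀ * (1 / 2 : ℝ) ^ i := by
    filter_upwards [hTΓ, hκT] with ω h1 h2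
    have hstep : ∀ i, ω ∈ T (κ i ω) (j₀ + i) → p i (κ i) (κ (i + 1) ω) ω := by
      intro i hi
      rw [hκ_succ]
      obtain ⟨y, hy, hyd⟩ := (h1 _ _).1 hi
      obtain ⟨k, hk⟩ := hx.exists_dist_lt y (by positivity : (0 : ℝ) < (1 / 2) ^ (j₀ + i + 1))
      refine Nat.sInf_mem (s := {k | p i (κ i) k ω}) ⟨k, (h1 _ _).2 ⟨y, hy, hk⟩, ?_⟩
      have hlt : (1 / 2 : ℝ) ^ (j₀ + i + 1) < (1 / 2 : ℝ) ^ (j₀ + i) :=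
        pow_lt_pow_right_of_lt_one₀ (by norm_num) (by norm_num) (by omega)
      have := dist_triangle_left (x k) (x (κ i ω)) y
      linarith
    have hmem : ∀ i, ω ∈ T (κ i ω) (j₀ + i) := by
      intro i
      induction i with
      | zero => exact h2
      | succ i ih => exact (hstep i ih).1
    intro i
    refine ⟨hmem i, ?_⟩
    rw [dist_comm, mul_assoc, ← pow_add]
    exact (hstep i (hmem i)).2.le
  have hlim : ∀ᵐ ω ∂μ, ∃ l, Tendsto (fun i => x (κ i ω)) atTop (𝓝 l) := by
    filter_upwards [hgood] with ω h
    exact cauchySeq_tendsto_of_complete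
      (cauchySeq_of_le_geometric (1 / 2) _ (by norm_num) fun i => (h i).2)
  obtain ⟨σ, hσ, hσlim⟩ := measurable_limit_of_tendsto_metrizable_ae
    (fun i => ((measurable_from_top (f := x)).comp (hκ i)).aemeasurable) hlim
  refine ⟨σ, hσ, ?_⟩
  filter_upwards [hTΓ, hgood, hσlim] with ω h1 h2 h3
  constructor
  · have hy : ∀ i, ∃ y ∈ Γ ω, dist y (x (κ i ω)) < (1 / 2 : ℝ) ^ (j₀ + i) := fun i =>
      (h1 _ _).1 (h2 i).1
    choose y hyΓ hyd using hy
    refine mem_closure_of_tendsto (f := y) (b := atTop) ?_ (Eventually.of_forall hyΓ)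
    refine tendsto_of_tendsto_of_dist h3 ?_
    refine squeeze_zero (fun _ => dist_nonneg) (fun i => ?_)
      (tendsto_pow_atTop_nhds_zero_of_lt_one (r := (1 / 2 : ℝ)) (by norm_num) (by norm_num))
    rw [Function.comp_apply, dist_comm]
    exact (hyd i).le.trans (pow_le_pow_of_le_one (by norm_num) (by norm_num) (by omega))
  · have := dist_le_of_le_geometric_of_tendsto₀ (1 / 2) _ (by norm_num) (fun i => (h2 i).2) h3
    refine this.trans (le_of_eq ?_)
    ring

/-- The Castaing representation of the closure of a set-valued map with measurable graph. -/
theorem exists_castaing [SecondCountableTopology 𝕏] [Nonempty 𝕏] (μ : Measure Ω)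
    [IsFiniteMeasure μ] {Γ : Ω → Set 𝕏} (hΓ : MeasurableSet {p : Ω × 𝕏 | p.2 ∈ Γ p.1})
    (hne : ∀ᵐ ω ∂μ, (Γ ω).Nonempty) :
    ∃ η : ℕ → Ω → 𝕏, (∀ n, Measurable (η n)) ∧
      ∀ᵐ ω ∂μ, (∀ n, η n ω ∈ closure (Γ ω)) ∧ Γ ω ⊆ closure (Set.range fun n => η n ω) := by
  classical
  let x := TopologicalSpace.denseSeq 𝕏
  have hx : DenseRange x := TopologicalSpace.denseRange_denseSeq 𝕏
  have hnull : ∀ k j : ℕ,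
      NullMeasurableSet {ω | ∃ y ∈ Γ ω, dist y (x k) < (1 / 2 : ℝ) ^ j} μ := by
    intro k j
    exact nullMeasurableSet_exists_mem (G := {p : Ω × 𝕏 | p.2 ∈ Γ p.1} ∩
      {p | dist p.2 (x k) < (1 / 2 : ℝ) ^ j}) μ
      (hΓ.inter (measurableSet_lt (measurable_snd.dist measurable_const) measurable_const))
  choose T _ hT hTeq using fun k j => (hnull k j).exists_measurable_superset_ae_eq
  have hTΓ : ∀ᵐ ω ∂μ, ∀ k j, ω ∈ T k j ↔ ∃ y ∈ Γ ω, dist y (x k) < (1 / 2 : ℝ) ^ j := by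
    refine ae_all_iff.2 fun k => ae_all_iff.2 fun j => ?_
    filter_upwards [hTeq k j] with ω h
    exact iff_of_eq h
  -- The selection starts near `x k` whenever `Γ ω` comes close enough to it. Otherwise the first
  -- dense point that works is used, so that the start is valid almost everywhere.
  let κ : ℕ → ℕ → Ω → ℕ := fun k j ω => if ω ∈ T k j then k else sInf {i | ω ∈ T i j}
  have hκ : ∀ k j, Measurable (κ k j) := fun k j =>
    Measurable.ite (hT k j) measurable_const (measurable_sInf_nat fun i => hT i j)
  have hκT : ∀ k j, ∀ᵐ ω ∂μ, ω ∈ T (κ k j ω) j := by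
    intro k j
    filter_upwards [hTΓ, hne] with ω h1 ⟨y, hy⟩
    by_cases h : ω ∈ T k j
    · simpa only [κ, if_pos h] using h
    · simp only [κ, if_neg h]
      obtain ⟨i, hi⟩ := hx.exists_dist_lt y (by positivity : (0 : ℝ) < (1 / 2) ^ j)
      exact Nat.sInf_mem (s := {i | ω ∈ T i j}) ⟨i, (h1 _ _).2 ⟨y, hy, hi⟩⟩
  choose σ hσ hσΓ using fun k j =>
    exists_measurable_selection_closure_of_start μ hx hT hTΓ j (hκ k j) (hκT k j)
  refine ⟨fun n => σ n.unpair.1 n.unpair.2, fun n => hσ _ _, ?_⟩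
  filter_upwards [hTΓ, ae_all_iff.2 fun k => ae_all_iff.2 fun j => hσΓ k j] with ω h1 h2
  refine ⟨fun n => (h2 _ _).1, fun y hy => Metric.mem_closure_range_iff.2 fun ε hε => ?_⟩
  -- The 5 counts one `2⁻ʲ` from `y` to `x k` and four from `x k` to the selection.
  obtain ⟨j, hj⟩ := exists_pow_lt_of_lt_one (by positivity : 0 < ε / 5)
    (by norm_num : (1 / 2 : ℝ) < 1)
  obtain ⟨k, hk⟩ := hx.exists_dist_lt y (by positivity : (0 : ℝ) < (1 / 2) ^ j)
  refine ⟨Nat.pair k j, ?_⟩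
  have hkj : κ k j ω = k := if_pos ((h1 k j).2 ⟨y, hy, hk⟩)
  have h3 := (h2 k j).2
  rw [hkj] at h3
  simp only [Nat.unpair_pair]
  linarith [dist_triangle y (x k) (σ k j ω)]

end

/-! ### Random functionals -/

section

variable {Ω 𝕏 : Type*} [NormedAddCommGroup 𝕏] [NormedSpace ℝ 𝕏]

theorem IsRandomDual.mono {H m : MeasurableSpace Ω} (hHm : H ≤ m) {ζ : Ω → StrongDual ℝ 𝕏}
    (hζ : IsRandomDual H ζ) : IsRandomDual m ζ :=
  fun x => (hζ x).mono hHm le_rfl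

/-- The pairing is measurable in `ω` for fixed `x` and continuous in `x`, so over a separable space
it is jointly measurable. -/
theorem IsRandomDual.measurable_apply [TopologicalSpace.SeparableSpace 𝕏]
    [MeasurableSpace 𝕏] [BorelSpace 𝕏] {m : MeasurableSpace Ω} {ζ : Ω → StrongDual ℝ 𝕏}
    (hζ : IsRandomDual m ζ) {ξ : Ω → 𝕏} (hξ : Measurable ξ) :
    Measurable fun ω => ζ ω (ξ ω) := by
  have : SecondCountableTopology 𝕏 := UniformSpace.secondCountable_of_separable 𝕏
  have h := measurable_uncurry_of_continuous_of_measurable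
    (u := fun (x : 𝕏) (ω : Ω) => ζ ω x) (fun ω => (ζ ω).continuous) hζ
  exact h.comp (hξ.prodMk measurable_id)

theorem IsRandomDual.measurable_norm [TopologicalSpace.SeparableSpace 𝕏] {m : MeasurableSpace Ω} {ζ : Ω → StrongDual ℝ 𝕏}
    (hζ : IsRandomDual m ζ) : Measurable fun ω => ‖ζ ω‖ := by
  refine measurable_of_Iic fun c => ?_
  rcases lt_or_ge c 0 with hc | hc
  · convert MeasurableSet.empty
    ext ω
    simpa using hc.trans_le (norm_nonneg (ζ ω))
  · have : (fun ω => ‖ζ ω‖) ⁻¹' Set.Iic c =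
        ⋂ k, {ω | |ζ ω (TopologicalSpace.denseSeq 𝕏 k)| ≤
          c * ‖TopologicalSpace.denseSeq 𝕏 k‖} := by
      ext ω
      simp only [Set.mem_preimage, Set.mem_Iic, Set.mem_iInter, Set.mem_ofPred_eq]
      rw [ContinuousLinearMap.opNorm_le_iff hc]
      refine ⟨fun h k => h _, fun h x => ?_⟩
      have hcl : IsClosed {x : 𝕏 | ‖ζ ω x‖ ≤ c * ‖x‖} :=
        isClosed_le (by fun_prop) (by fun_prop)
      exact hcl.closure_subset_iff.2 (Set.range_subset_iff.2 h)
        (TopologicalSpace.denseRange_denseSeq 𝕏 x)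
    rw [this]
    exact MeasurableSet.iInter fun k =>
      measurableSet_le (hζ _).norm measurable_const

end

section

variable {Ω 𝕏 : Type*} {H mF : MeasurableSpace Ω} {P : Measure[mF] Ω}
  [NormedAddCommGroup 𝕏] [NormedSpace ℝ 𝕏]
  [TopologicalSpace.SeparableSpace 𝕏] [MeasurableSpace 𝕏] [BorelSpace 𝕏]

theorem integrable_dual_apply (hH : H ≤ mF) {ζ : Ω → StrongDual ℝ 𝕏} (hζ : IsRandomDual H ζ)
    {C : ℝ} (hC : ∀ ω, ‖ζ ω‖ ≤ C) {f : Ω → 𝕏} (hf : Integrable f P) :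
    Integrable (fun ω => ζ ω (f ω)) P := by
  refine (hf.norm.const_mul C).mono' ?_ (Eventually.of_forall fun ω => ?_)
  · obtain ⟨g, hg, hfg⟩ := hf.1.aemeasurable
    exact ⟨_, ((hζ.mono hH).measurable_apply hg).stronglyMeasurable, by
      filter_upwards [hfg] with ω h
      rw [h]⟩
  · exact ((ζ ω).le_opNorm _).trans (mul_le_mul_of_nonneg_right (hC ω) (norm_nonneg _))

variable [IsProbabilityMeasure P] [CompleteSpace 𝕏]

/-- Conditional expectation contracts `L¹` and `ζ` is bounded, so the defect in the pull-out formula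
is Lipschitz in `f`. This lets the formula pass to `L¹` limits. -/
theorem integral_abs_condExp_dual_apply_sub_le (hH : H ≤ mF) {ζ : Ω → StrongDual ℝ 𝕏}
    (hζ : IsRandomDual H ζ) {C : ℝ} (hC : ∀ ω, ‖ζ ω‖ ≤ C) {f : Ω → 𝕏} (hf : Integrable f P) :
    ∫ ω, |(P[fun ω => ζ ω (f ω)|H]) ω - ζ ω ((P[f|H]) ω)| ∂P ≤ 2 * C * ∫ ω, ‖f ω‖ ∂P := by
  have hle : ∀ (ω : Ω) (x : 𝕏), |ζ ω x| ≤ C * ‖x‖ := fun ω x =>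
    ((ζ ω).le_opNorm _).trans (mul_le_mul_of_nonneg_right (hC ω) (norm_nonneg _))
  have hC0 : 0 ≤ C := by
    obtain ⟨ω⟩ := P.nonempty_of_neZero
    exact (norm_nonneg _).trans (hC ω)
  have h1 : ∫ ω, |(P[fun ω => ζ ω (f ω)|H]) ω| ∂P ≤ C * ∫ ω, ‖f ω‖ ∂P := by
    refine (integral_abs_condExp_le _).trans ?_
    rw [← integral_const_mul]
    exact integral_mono (integrable_dual_apply hH hζ hC hf).abs (hf.norm.const_mul C)
      fun ω => hle ω _
  have h2 : ∫ ω, |ζ ω ((P[f|H]) ω)| ∂P ≤ C * ∫ ω, ‖f ω‖ ∂P := by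
    refine le_trans ?_ (mul_le_mul_of_nonneg_left (integral_norm_condExp_le (m := H) f) hC0)
    rw [← integral_const_mul]
    exact integral_mono (integrable_dual_apply hH hζ hC integrable_condExp).abs
      (integrable_condExp.norm.const_mul C) fun ω => hle ω _
  have i1 : Integrable (P[fun ω => ζ ω (f ω)|H]) P := integrable_condExp
  have i2 : Integrable (fun ω => ζ ω ((P[f|H]) ω)) P :=
    integrable_dual_apply hH hζ hC integrable_condExp
  calc ∫ ω, |(P[fun ω => ζ ω (f ω)|H]) ω - ζ ω ((P[f|H]) ω)| ∂P
      ≤ ∫ ω, (|(P[fun ω => ζ ω (f ω)|H]) ω| + |ζ ω ((P[f|H]) ω)|) ∂P :=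
        integral_mono (i1.sub i2).abs (i1.abs.add i2.abs) fun ω => abs_sub _ _
    _ = _ := integral_add i1.abs i2.abs
    _ ≤ 2 * C * ∫ ω, ‖f ω‖ ∂P := by linarith

/-- The pull-out property for bounded random functionals. -/
theorem condExp_dual_apply (hH : H ≤ mF) {ζ : Ω → StrongDual ℝ 𝕏} (hζ : IsRandomDual H ζ)
    {C : ℝ} (hC : ∀ ω, ‖ζ ω‖ ≤ C) {f : Ω → 𝕏} (hf : Integrable f P) :
    P[fun ω => ζ ω (f ω)|H] =ᵐ[P] fun ω => ζ ω ((P[f|H]) ω) := by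
  refine Integrable.induction
    (fun f : Ω → 𝕏 => P[fun ω => ζ ω (f ω)|H] =ᵐ[P] fun ω => ζ ω ((P[f|H]) ω)) ?_ ?_ ?_ ?_ hf
  · intro c s hs _
    have hs1 : Integrable (s.indicator fun _ => (1 : ℝ)) P := (integrable_const _).indicator hs
    have e1 : (fun ω => ζ ω (s.indicator (fun _ => c) ω)) =
        (fun ω => ζ ω c) * s.indicator fun _ => (1 : ℝ) := by
      ext ω
      by_cases h : ω ∈ s <;> simp [h]
    have e2 : (s.indicator fun _ => c) =
        ContinuousLinearMap.toSpanSingleton ℝ c ∘ s.indicator fun _ => (1 : ℝ) := by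
      ext ω
      by_cases h : ω ∈ s <;> simp [h]
    have hint : Integrable ((fun ω => ζ ω c) * s.indicator fun _ => (1 : ℝ)) P := by
      rw [← e1]
      exact integrable_dual_apply hH hζ hC ((integrable_const c).indicator hs)
    have h2 := ContinuousLinearMap.comp_condExp_comm (m := H) hs1
      (ContinuousLinearMap.toSpanSingleton ℝ c)
    rw [e1, e2]
    filter_upwards [condExp_mul_of_stronglyMeasurable_left (hζ c).stronglyMeasurable hint hs1, h2]
      with ω h1 h2
    rw [h1, ← h2]
    simp [mul_comm]
  · intro f g _ hf hg ihf ihg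
    have e : (fun ω => ζ ω ((f + g) ω)) = (fun ω => ζ ω (f ω)) + fun ω => ζ ω (g ω) := by
      ext ω
      simp
    rw [e]
    filter_upwards [condExp_add (integrable_dual_apply hH hζ hC hf)
      (integrable_dual_apply hH hζ hC hg) H, condExp_add hf hg H, ihf, ihg] with ω h1 h2 h3 h4
    rw [h1, h2, Pi.add_apply, Pi.add_apply, h3, h4, map_add]
  · refine isClosed_of_closure_subset fun f hf => ?_
    have hC0 : 0 ≤ C := by
      obtain ⟨ω⟩ := P.nonempty_of_neZero
      exact (norm_nonneg _).trans (hC ω)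
    have hint : ∀ g : Ω → 𝕏, Integrable g P →
        Integrable (fun ω => (P[fun ω => ζ ω (g ω)|H]) ω - ζ ω ((P[g|H]) ω)) P := fun g _ =>
      integrable_condExp.sub (integrable_dual_apply hH hζ hC integrable_condExp)
    have hzero : ∫ ω, |(P[fun ω => ζ ω (f ω)|H]) ω - ζ ω ((P[f|H]) ω)| ∂P ≤ 0 := by
      refine le_of_forall_pos_le_add fun ε hε => ?_
      -- The `+ 1` only prevents division by zero when `C = 0`.
      obtain ⟨g, hg, hfg⟩ := Metric.mem_closure_iff.1 hf (ε / (2 * C + 1)) (by positivity)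
      have hfi := L1.integrable_coeFn f
      have hgi := L1.integrable_coeFn g
      have hle := integral_abs_condExp_dual_apply_sub_le hH hζ hC (hfi.sub hgi)
      have hd : ∫ ω, ‖(f - g : Ω → 𝕏) ω‖ ∂P = dist f g := by
        rw [L1.dist_def, integral_norm_eq_lintegral_enorm (hfi.sub hgi).1]
        simp_rw [edist_eq_enorm_sub]
        rfl
      have hcongr : ∫ ω, |(P[fun ω => ζ ω (f ω)|H]) ω - ζ ω ((P[f|H]) ω)| ∂P =
          ∫ ω, |(P[fun ω => ζ ω ((f - g : Ω → 𝕏) ω)|H]) ω - ζ ω ((P[(f - g : Ω → 𝕏)|H]) ω)| ∂P := by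
        have e : (fun ω => ζ ω ((f - g : Ω → 𝕏) ω)) =
            (fun ω => ζ ω (f ω)) - fun ω => ζ ω (g ω) := by
          ext ω
          simp
        refine integral_congr_ae ?_
        rw [e]
        filter_upwards [condExp_sub (integrable_dual_apply hH hζ hC hfi)
          (integrable_dual_apply hH hζ hC hgi) H, condExp_sub hfi hgi H, hg] with ω h1 h2 h3
        rw [h1, h2, Pi.sub_apply, Pi.sub_apply, h3, map_sub]
        ring_nf
      rw [hcongr, zero_add]
      refine hle.trans ?_
      rw [hd]
      have := hfg.le
      rw [le_div_iff₀ (by positivity)] at this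
      nlinarith [dist_nonneg (x := f) (y := g)]
    have h0 := (integral_eq_zero_iff_of_nonneg (fun ω => abs_nonneg _)
      (hint f (L1.integrable_coeFn f)).abs).1
      (le_antisymm hzero (integral_nonneg fun ω => abs_nonneg _))
    filter_upwards [h0] with ω h
    exact sub_eq_zero.1 (abs_eq_zero.1 h)
  · intro f g hfg hf ih
    have h1 : (fun ω => ζ ω (f ω)) =ᵐ[P] fun ω => ζ ω (g ω) := by
      filter_upwards [hfg] with ω h
      rw [h]
    filter_upwards [condExp_congr_ae (m := H) h1, condExp_congr_ae (m := H) hfg, ih]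
      with ω h1 h2 h3
    rw [← h1, ← h2, h3]

end

/-! ### Measurable partitions -/

section

variable {Ω : Type*} {H : MeasurableSpace Ω} {A B : ℕ → Set Ω}

theorem IsMeasurablePartition.exists_mem (hA : IsMeasurablePartition H A) (ω : Ω) :
    ∃ i, ω ∈ A i :=
  Set.mem_iUnion.1 (hA.2.2 ▸ Set.mem_univ ω)

theorem IsMeasurablePartition.eq_of_mem (hA : IsMeasurablePartition H A) {ω : Ω} {i j : ℕ}
    (hi : ω ∈ A i) (hj : ω ∈ A j) : i = j := by
  by_contra hij
  exact Set.disjoint_left.1 (hA.2.1 hij) hi hj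

theorem IsMeasurablePartition.sigma (hA : IsMeasurablePartition H A) {B : ℕ → ℕ → Set Ω}
    (hB : ∀ n, IsMeasurablePartition H (B n)) :
    IsMeasurablePartition H fun n => A n.unpair.1 ∩ B n.unpair.1 n.unpair.2 := by
  refine ⟨fun n => (hA.1 _).inter ((hB _).1 _), fun m n hmn => ?_, ?_⟩
  · refine Set.disjoint_left.2 fun ω hm hn => hmn ?_
    have h1 := hA.eq_of_mem hm.1 hn.1
    have h2 := (hB _).eq_of_mem hm.2 (h1 ▸ hn.2)
    rw [← Nat.pair_unpair m, ← Nat.pair_unpair n, h1, h2]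
  · refine Set.eq_univ_of_forall fun ω => ?_
    obtain ⟨i, hi⟩ := hA.exists_mem ω
    obtain ⟨j, hj⟩ := (hB i).exists_mem ω
    exact Set.mem_iUnion.2 ⟨Nat.pair i j, by simpa using ⟨hi, hj⟩⟩

theorem IsMeasurablePartition.inter (hA : IsMeasurablePartition H A)
    (hB : IsMeasurablePartition H B) :
    IsMeasurablePartition H fun n => A n.unpair.1 ∩ B n.unpair.2 :=
  hA.sigma fun _ => hB

theorem isMeasurablePartition_fiber {κ : Ω → ℕ} (hκ : Measurable[H] κ) :
    IsMeasurablePartition H fun n => {ω | κ ω = n} := by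
  refine ⟨fun n => hκ (measurableSet_singleton n), fun m n hmn => ?_, ?_⟩
  · exact Set.disjoint_left.2 fun ω hm hn => hmn (hm.symm.trans hn)
  · exact Set.eq_univ_of_forall fun ω => Set.mem_iUnion.2 ⟨κ ω, rfl⟩

theorem IsMeasurablePartition.ae_of_forall {mF : MeasurableSpace Ω} {P : Measure[mF] Ω}
    (hA : IsMeasurablePartition H A) {p : Ω → Prop} (h : ∀ i, ∀ᵐ ω ∂P, ω ∈ A i → p ω) :
    ∀ᵐ ω ∂P, p ω := by
  filter_upwards [ae_all_iff.2 h] with ω hω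
  obtain ⟨i, hi⟩ := hA.exists_mem ω
  exact hω i hi

theorem IsMeasurablePartition.measurable_of_forall {β : Type*} [MeasurableSpace β]
    (hA : IsMeasurablePartition H A) {f : Ω → β} {g : ℕ → Ω → β} (hg : ∀ i, Measurable[H] (g i))
    (h : ∀ i, ∀ ω ∈ A i, f ω = g i ω) : Measurable[H] f := by
  intro S hS
  have : f ⁻¹' S = ⋃ i, A i ∩ g i ⁻¹' S := by
    ext ω
    simp only [Set.mem_preimage, Set.mem_iUnion, Set.mem_inter_iff]
    constructor
    · intro hf
      obtain ⟨i, hi⟩ := hA.exists_mem ω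
      exact ⟨i, hi, h i ω hi ▸ hf⟩
    · rintro ⟨i, hi, hgi⟩
      rwa [h i ω hi]
  rw [this]
  exact MeasurableSet.iUnion fun i => (hA.1 i).inter (hg i hS)

end

/-! ### Generalised conditional expectations of random elements -/

section

variable {Ω 𝕏 : Type*} {H mF : MeasurableSpace Ω} {P : Measure[mF] Ω}
  [NormedAddCommGroup 𝕏] [MeasurableSpace 𝕏]

theorem CondIntegrable.piecewise (hH : H ≤ mF) {ξ ξ' : Ω → 𝕏} (hξ : CondIntegrable H P ξ)
    (hξ' : CondIntegrable H P ξ') {S : Set Ω} [DecidablePred (· ∈ S)] (hS : MeasurableSet S) :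
    CondIntegrable H P (S.piecewise ξ ξ') := by
  obtain ⟨hξm, A, hA, hAi⟩ := hξ
  obtain ⟨hξm', A', hA', hAi'⟩ := hξ'
  refine ⟨hξm.piecewise hS hξm', _, hA.inter hA', fun n => ?_⟩
  -- `S` need not belong to `H`, so it cannot enter the partition. It is moved into the summands,
  -- where measurability in the large σ-algebra suffices.
  have e : (A n.unpair.1 ∩ A' n.unpair.2).indicator (S.piecewise ξ ξ') =
      (A' n.unpair.2 ∩ S).indicator ((A n.unpair.1).indicator ξ) +
        (A n.unpair.1 ∩ Sᶜ).indicator ((A' n.unpair.2).indicator ξ') := by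
    ext ω
    by_cases h1 : ω ∈ A n.unpair.1 <;> by_cases h2 : ω ∈ A' n.unpair.2 <;>
      by_cases h3 : ω ∈ S <;> simp [h1, h2, h3]
  rw [e]
  exact ((hAi _).indicator ((hH _ (hA'.1 _)).inter hS)).add
    ((hAi' _).indicator ((hH _ (hA.1 _)).inter hS.compl))

theorem condIntegrable_of_partition (hH : H ≤ mF) {B : ℕ → Set Ω}
    (hB : IsMeasurablePartition H B) {ξ : ℕ → Ω → 𝕏} (hξ : ∀ n, CondIntegrable H P (ξ n))
    {χ : Ω → 𝕏} (hχ : ∀ n, ∀ ω ∈ B n, χ ω = ξ n ω) : CondIntegrable H P χ := by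
  choose hm A hA hAi using hξ
  have hB' : IsMeasurablePartition mF B := ⟨fun i => hH _ (hB.1 i), hB.2⟩
  refine ⟨hB'.measurable_of_forall hm hχ, _, hB.sigma hA, fun n => ?_⟩
  have e : (B n.unpair.1 ∩ A n.unpair.1 n.unpair.2).indicator χ =
      (B n.unpair.1).indicator ((A n.unpair.1 n.unpair.2).indicator (ξ n.unpair.1)) := by
    ext ω
    by_cases h1 : ω ∈ B n.unpair.1 <;> by_cases h2 : ω ∈ A n.unpair.1 n.unpair.2 <;>
      simp [h1, h2]
    exact hχ _ _ h1
  rw [e]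
  exact (hAi _ _).indicator (hH _ (hB.1 _))

variable [NormedSpace ℝ 𝕏] [CompleteSpace 𝕏]

theorem genCondExp_apply {ξ : Ω → 𝕏} (hξ : CondIntegrable H P ξ) {i : ℕ} {ω : Ω}
    (hω : ω ∈ hξ.2.choose i) :
    genCondExp H P ξ ω = (P[(hξ.2.choose i).indicator ξ|H]) ω := by
  have hA := hξ.2.choose_spec.1
  rw [genCondExp, dif_pos hξ]
  refine (tsum_eq_single i fun j hj => ?_).trans (Set.indicator_of_mem hω _)
  exact Set.indicator_of_notMem (fun hωj => hj (hA.eq_of_mem hωj hω)) _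

theorem measurable_genCondExp [BorelSpace 𝕏] (ξ : Ω → 𝕏) : Measurable[H] (genCondExp H P ξ) := by
  by_cases hξ : CondIntegrable H P ξ
  · exact hξ.2.choose_spec.1.measurable_of_forall
      (fun i => (stronglyMeasurable_condExp (m := H)).measurable) fun i ω hω =>
        genCondExp_apply hξ hω
  · rw [genCondExp, dif_neg hξ]
    exact measurable_const

/-- This frees the definition from its chosen partition: on a piece of that partition, both
indicators can be pulled out of the conditional expectation in either order. -/
theorem indicator_genCondExp {ξ : Ω → 𝕏} (hξ : CondIntegrable H P ξ) {B : Set Ω}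
    (hB : MeasurableSet[H] B) (hint : Integrable (B.indicator ξ) P) :
    B.indicator (genCondExp H P ξ) =ᵐ[P] P[B.indicator ξ|H] := by
  have hA := hξ.2.choose_spec.1
  have hAi := hξ.2.choose_spec.2
  refine hA.ae_of_forall fun i => ?_
  have h1 := condExp_indicator (m := H) hint (hA.1 i)
  have h2 := condExp_indicator (m := H) (hAi i) hB
  have e : (hξ.2.choose i).indicator (B.indicator ξ) =
      B.indicator ((hξ.2.choose i).indicator ξ) := by
    rw [Set.indicator_indicator, Set.indicator_indicator, Set.inter_comm]
  rw [e] at h1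
  filter_upwards [h1, h2] with ω h1 h2 hω
  rw [h2, Set.indicator_of_mem hω] at h1
  rw [← h1]
  by_cases hωB : ω ∈ B
  · rw [Set.indicator_of_mem hωB, Set.indicator_of_mem hωB, genCondExp_apply hξ hω]
  · rw [Set.indicator_of_notMem hωB, Set.indicator_of_notMem hωB]

theorem genCondExp_eq_on (hH : H ≤ mF) {ξ ξ' : Ω → 𝕏} (hξ : CondIntegrable H P ξ)
    (hξ' : CondIntegrable H P ξ') {B : Set Ω} (hB : MeasurableSet[H] B)
    (h : ∀ ω ∈ B, ξ ω = ξ' ω) : ∀ᵐ ω ∂P, ω ∈ B → genCondExp H P ξ ω = genCondExp H P ξ' ω := by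
  obtain ⟨-, A, hA, hAi⟩ := id hξ
  refine hA.ae_of_forall fun i => ?_
  have hm : MeasurableSet[H] (A i ∩ B) := (hA.1 i).inter hB
  have e : (A i ∩ B).indicator ξ = (A i ∩ B).indicator ξ' := by
    ext ω
    by_cases hω : ω ∈ A i ∩ B
    · rw [Set.indicator_of_mem hω, Set.indicator_of_mem hω, h ω hω.2]
    · rw [Set.indicator_of_notMem hω, Set.indicator_of_notMem hω]
  have hint : Integrable ((A i ∩ B).indicator ξ) P := by
    rw [Set.inter_comm, ← Set.indicator_indicator]
    exact (hAi i).indicator (hH _ hB)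
  filter_upwards [indicator_genCondExp hξ hm hint, indicator_genCondExp hξ' hm (e ▸ hint)]
    with ω h1 h2 hωA hωB
  have hω : ω ∈ A i ∩ B := ⟨hωA, hωB⟩
  rw [Set.indicator_of_mem hω] at h1 h2
  rw [h1, h2, e]

end

/-! ### Conditional expectations of nonnegative random variables -/

section

variable {Ω : Type*} {H mF : MeasurableSpace Ω} {P : Measure[mF] Ω} [IsProbabilityMeasure P]

theorem condLExp_indicator (hH : H ≤ mF) (f : Ω → ℝ≥0∞) {B : Set Ω} (hB : MeasurableSet[H] B) :
    P⁻[B.indicator f|H] =ᵐ[P] B.indicator (P⁻[f|H]) := by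
  refine (ae_eq_condLExp hH P _ ((measurable_condLExp H P f).indicator hB) fun s hs => ?_).symm
  rw [setLIntegral_indicator (hH _ hB), setLIntegral_indicator (hH _ hB),
    setLIntegral_condLExp hH P f (hB.inter hs)]

theorem condLExp_iSup (hH : H ≤ mF) {f : ℕ → Ω → ℝ≥0∞} (hf : ∀ n, Measurable (f n))
    (hmono : Monotone f) :
    P⁻[fun ω => ⨆ n, f n ω|H] =ᵐ[P] fun ω => ⨆ n, (P⁻[f n|H]) ω := by
  refine (ae_eq_condLExp hH P _ (.iSup fun n => measurable_condLExp H P (f n))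
    fun s hs => ?_).symm
  rw [lintegral_iSup hf hmono, lintegral_iSup' (fun n => (measurable_condLExp' H P _).aemeasurable)]
  · exact iSup_congr fun n => setLIntegral_condLExp hH P (f n) hs
  · refine ae_restrict_of_ae ?_
    have : ∀ n, ∀ᵐ ω ∂P, (P⁻[f n|H]) ω ≤ (P⁻[f (n + 1)|H]) ω := fun n =>
      condLExp_mono (Eventually.of_forall (hmono n.le_succ))
    filter_upwards [ae_all_iff.2 this] with ω h
    exact monotone_nat_of_le_succ h

/-- Conditional expectations of the positive and the negative part of a real random variable whose
conditional expectation is `γ`. -/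
theorem condLExp_ofReal_of_partition (hH : H ≤ mF) {g γ : Ω → ℝ} {B : ℕ → Set Ω}
    (hB : IsMeasurablePartition H B) (hint : ∀ i, Integrable ((B i).indicator g) P)
    (hγ : ∀ i, ∀ᵐ ω ∂P, ω ∈ B i → γ ω = (P[(B i).indicator g|H]) ω) :
    ∀ᵐ ω ∂P, (P⁻[fun ω => ENNReal.ofReal (g ω)|H]) ω < ⊤ ∧
      (P⁻[fun ω => ENNReal.ofReal (-g ω)|H]) ω < ⊤ ∧
      γ ω = ((P⁻[fun ω => ENNReal.ofReal (g ω)|H]) ω).toReal -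
        ((P⁻[fun ω => ENNReal.ofReal (-g ω)|H]) ω).toReal := by
  refine hB.ae_of_forall fun i => ?_
  have hpos := (hint i).pos_part
  have hneg := (hint i).neg_part
  have e1 : (B i).indicator (fun ω => ENNReal.ofReal (g ω)) =
      fun ω => ENNReal.ofReal (max ((B i).indicator g ω) 0) := by
    ext ω
    by_cases h : ω ∈ B i <;> simp [h]
  have e2 : (B i).indicator (fun ω => ENNReal.ofReal (-g ω)) =
      fun ω => ENNReal.ofReal (max (-(B i).indicator g ω) 0) := by
    ext ω
    by_cases h : ω ∈ B i <;> simp [h]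
  have e3 : (B i).indicator g = (fun ω => max ((B i).indicator g ω) 0) -
      fun ω => max (-(B i).indicator g ω) 0 := by
    ext ω
    exact (max_zero_sub_max_neg_zero_eq_self _).symm
  have c1 := condLExp_indicator (P := P) hH (fun ω => ENNReal.ofReal (g ω)) (hB.1 i)
  have c2 := condLExp_indicator (P := P) hH (fun ω => ENNReal.ofReal (-g ω)) (hB.1 i)
  rw [e1] at c1
  rw [e2] at c2
  have hp0 : (0 : Ω → ℝ) ≤ᵐ[P] fun ω => max ((B i).indicator g ω) 0 :=
    Eventually.of_forall fun ω => le_max_right _ _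
  have hn0 : (0 : Ω → ℝ) ≤ᵐ[P] fun ω => max (-(B i).indicator g ω) 0 :=
    Eventually.of_forall fun ω => le_max_right _ _
  have c3 := condExp_sub hpos hneg H
  rw [← e3] at c3
  filter_upwards [c1, c2, condLExp_ofReal H hpos hp0, condLExp_ofReal H hneg hn0, c3,
    condExp_nonneg (m := H) hp0, condExp_nonneg (m := H) hn0, hγ i]
    with ω c1 c2 d1 d2 c3 n1 n2 hγ hω
  rw [Set.indicator_of_mem hω] at c1 c2
  rw [← c1, ← c2, d1, d2, hγ hω, c3, ENNReal.toReal_ofReal n1, ENNReal.toReal_ofReal n2]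
  exact ⟨ENNReal.ofReal_lt_top, ENNReal.ofReal_lt_top, rfl⟩

/-- This is h = g + (h - g) with the negative parts moved across. No subtraction remains among the
parts, so conditional expectations can be added even where they are infinite. -/
theorem toENNReal_add_ofReal_neg_eq {h : EReal} {g : ℝ} (hgh : (g : EReal) ≤ h) :
    h.toENNReal + ENNReal.ofReal (-g) =
      (-h).toENNReal + ENNReal.ofReal g + (h - g).toENNReal := by
  induction h with
  | bot => simp at hgh
  | top => simp
  | coe r =>
    have hgr : g ≤ r := EReal.coe_le_coe_iff.1 hgh
    rw [← EReal.coe_neg, ← EReal.coe_sub, EReal.toENNReal_of_ne_top (EReal.coe_ne_top _),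
      EReal.toENNReal_of_ne_top (EReal.coe_ne_top _),
      EReal.toENNReal_of_ne_top (EReal.coe_ne_top _)]
    simp only [EReal.toReal_coe]
    rw [← max_zero_sub_max_neg_zero_eq_self g, ← max_zero_sub_max_neg_zero_eq_self r] at hgr
    have key : max r 0 + max (-g) 0 = max (-r) 0 + max g 0 + (r - g) := by
      linarith [max_zero_sub_max_neg_zero_eq_self g, max_zero_sub_max_neg_zero_eq_self r]
    have hrg : 0 ≤ r - g := by
      linarith [max_zero_sub_max_neg_zero_eq_self g, max_zero_sub_max_neg_zero_eq_self r]
    have aux : ∀ a : ℝ, ENNReal.ofReal a = ENNReal.ofReal (max a 0) := fun a => by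
      rw [ENNReal.ofReal_max]
      simp
    rw [aux r, aux (-g), aux (-r), aux g, ← ENNReal.ofReal_add (by positivity) (by positivity),
      ← ENNReal.ofReal_add (by positivity) (by positivity),
      ← ENNReal.ofReal_add (by positivity) hrg, key]

/-- Finiteness of `b`, `p` and `q` allows the terms to be moved back; `k` may be infinite, and then
`a` must be infinite too. -/
theorem coe_sub_coe_eq_of_add_eq {a b p q k : ℝ≥0∞} (hb : b < ⊤) (hp : p < ⊤) (hq : q < ⊤)
    (h : a + q = b + p + k) :
    (a : EReal) - (b : EReal) = ((p.toReal - q.toReal : ℝ) : EReal) + (k : EReal) := by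
  lift b to NNReal using hb.ne
  lift p to NNReal using hp.ne
  lift q to NNReal using hq.ne
  by_cases hk : k = ⊤
  · subst hk
    have ha : a = ⊤ := by
      by_contra ha
      lift a to NNReal using ha
      rw [add_top, ← ENNReal.coe_add] at h
      exact ENNReal.coe_ne_top h
    subst ha
    simp
    rfl
  · have ha : a ≠ ⊤ := by
      rintro rfl
      rw [top_add] at h
      exact ENNReal.add_ne_top.2 ⟨by simp, hk⟩ h.symm
    lift a to NNReal using ha
    lift k to NNReal using hk
    have h' : (a : ℝ) + q = b + p + k := by exact_mod_cast h
    have e : ((a : ℝ) : EReal) - ((b : ℝ) : EReal) =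
        (((p : ℝ) - (q : ℝ) : ℝ) : EReal) + ((k : ℝ) : EReal) := by
      rw [← EReal.coe_sub, ← EReal.coe_add]
      congr 1
      linarith
    exact e

/-- If `h` dominates a real random variable `g` with conditional expectation `γ`, then
`E(h | H) = γ + E(h - g | H)`. -/
theorem genCondExpE_eq_add (hH : H ≤ mF) {g γ : Ω → ℝ} {B : ℕ → Set Ω}
    (hB : IsMeasurablePartition H B) (hg : Measurable g)
    (hint : ∀ i, Integrable ((B i).indicator g) P)
    (hγ : ∀ i, ∀ᵐ ω ∂P, ω ∈ B i → γ ω = (P[(B i).indicator g|H]) ω)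
    {h : Ω → EReal} (hh : Measurable h) (hgh : ∀ᵐ ω ∂P, (g ω : EReal) ≤ h ω) :
    HasGenCondExpE H P h ∧ genCondExpE H P h =ᵐ[P] fun ω =>
      (γ ω : EReal) + ((P⁻[fun ω => (h ω - g ω).toENNReal|H]) ω : EReal) := by
  have hparts := condLExp_ofReal_of_partition hH hB hint hγ
  have hneg : P⁻[fun ω => (-h ω).toENNReal|H] ≤ᵐ[P] P⁻[fun ω => ENNReal.ofReal (-g ω)|H] := by
    refine condLExp_mono ?_
    filter_upwards [hgh] with ω hω
    have h1 : -h ω ≤ ((-g ω : ℝ) : EReal) := by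
      rw [EReal.coe_neg]
      exact EReal.neg_le_neg_iff.2 hω
    refine (EReal.toENNReal_le_toENNReal h1).trans (le_of_eq ?_)
    rw [EReal.toENNReal_of_ne_top (EReal.coe_ne_top _), EReal.toReal_coe]
  have hm1 : Measurable fun ω => (h ω).toENNReal := hh.ereal_toENNReal
  have hm2 : Measurable fun ω => (-h ω).toENNReal := hh.neg.ereal_toENNReal
  have hg' : Measurable fun ω => ENNReal.ofReal (g ω) := hg.ennreal_ofReal
  have hsum : P⁻[(fun ω => (h ω).toENNReal) + fun ω => ENNReal.ofReal (-g ω)|H] =ᵐ[P]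
      P⁻[((fun ω => (-h ω).toENNReal) + fun ω => ENNReal.ofReal (g ω)) +
        fun ω => (h ω - g ω).toENNReal|H] := by
    refine condLExp_congr_ae ?_
    filter_upwards [hgh] with ω hω
    exact toENNReal_add_ofReal_neg_eq hω
  have hfin : ∀ᵐ ω ∂P, (P⁻[fun ω => (-h ω).toENNReal|H]) ω < ⊤ := by
    filter_upwards [hneg, hparts] with ω h1 h2
    exact h1.trans_lt h2.2.1
  refine ⟨⟨hh, hfin⟩, ?_⟩
  filter_upwards [hparts, hfin, hsum,
    condLExp_add_left (mΩ := H) (P := P) (fun ω => ENNReal.ofReal (-g ω)) hm1.aemeasurable,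
    condLExp_add_left (mΩ := H) (P := P) (fun ω => (h ω - g ω).toENNReal)
      (hm2.add hg').aemeasurable,
    condLExp_add_left (mΩ := H) (P := P) (fun ω => ENNReal.ofReal (g ω)) hm2.aemeasurable]
    with ω h1 h2 h3 h4 h5 h6
  rw [h4, h5, Pi.add_apply, Pi.add_apply, h6, Pi.add_apply] at h3
  rw [genCondExpE, h1.2.2]
  exact coe_sub_coe_eq_of_add_eq h2 h1.1 h1.2.1 h3

end

/-! ### Decomposable families of random elements -/

section

variable {Ω 𝕏 : Type*} {H mF : MeasurableSpace Ω} {P : Measure[mF] Ω}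
  [NormedAddCommGroup 𝕏] [MeasurableSpace 𝕏]

/-- The family `Ξ` is stable under gluing along countable `H`-measurable partitions. -/
def IsDecomposable (H : MeasurableSpace Ω) {mF : MeasurableSpace Ω} (P : Measure[mF] Ω)
    (Ξ : Set (Ω → 𝕏)) : Prop :=
  ∀ (ξ : ℕ → Ω → 𝕏) (B : ℕ → Set Ω), (∀ n, ξ n ∈ Ξ) → IsMeasurablePartition H B →
    ∃ χ ∈ Ξ, ∀ᵐ ω ∂P, ∀ n, ω ∈ B n → χ ω = ξ n ω

theorem measurableSet_dist_lt {m : MeasurableSpace Ω} [SecondCountableTopology 𝕏] [BorelSpace 𝕏]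
    {f g : Ω → 𝕏} (hf : Measurable f) (hg : Measurable g) (r : ℝ) :
    MeasurableSet {ω | dist (f ω) (g ω) < r} :=
  measurableSet_lt (hf.dist hg) measurable_const

theorem measurableSet_closure_graph [SecondCountableTopology 𝕏] [BorelSpace 𝕏] {ξ : ℕ → Ω → 𝕏}
    (hξ : ∀ n, Measurable[H] (ξ n)) :
    MeasurableSet[H.prod inferInstance]
      {p : Ω × 𝕏 | p.2 ∈ closure (Set.range fun n => ξ n p.1)} := by
  have e : {p : Ω × 𝕏 | p.2 ∈ closure (Set.range fun n => ξ n p.1)} =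
      ⋂ m : ℕ, ⋃ n, {p : Ω × 𝕏 | dist p.2 (ξ n p.1) < 1 / ((m : ℝ) + 1)} := by
    ext p
    simp only [Set.mem_iInter, Set.mem_iUnion, Set.mem_ofPred_eq, Metric.mem_closure_range_iff]
    refine ⟨fun h m => h _ (by positivity), fun h ε hε => ?_⟩
    obtain ⟨m, hm⟩ := exists_nat_one_div_lt hε
    obtain ⟨n, hn⟩ := h m
    exact ⟨n, hn.trans hm⟩
  rw [e]
  exact MeasurableSet.iInter fun m => MeasurableSet.iUnion fun n =>
    measurableSet_lt (measurable_snd.dist ((hξ n).comp measurable_fst)) measurable_const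

variable [IsProbabilityMeasure P]

/-- The `ξ n` nearly minimise the expected truncated distance to `x`. Taking whichever of `χ` and `ξ
n` is nearer stays in the family, so the mean excess of `ξ n` over `χ` is at most 1/(n + 1). -/
theorem IsDecomposable.ae_iInf_tsub_eq_zero [SecondCountableTopology 𝕏] [BorelSpace 𝕏]
    (hH : H ≤ mF) {Ξ : Set (Ω → 𝕏)}
    (hm : ∀ ξ ∈ Ξ, Measurable[H] ξ) (hd : IsDecomposable H P Ξ) (x : 𝕏) {ξ : ℕ → Ω → 𝕏}
    (hξ : ∀ n, ξ n ∈ Ξ)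
    (hlt : ∀ n, ∫⁻ ω, min 1 (edist x (ξ n ω)) ∂P ≤
      (⨅ χ ∈ Ξ, ∫⁻ ω, min 1 (edist x (χ ω)) ∂P) + ((n : ℝ≥0∞) + 1)⁻¹)
    {χ : Ω → 𝕏} (hχ : χ ∈ Ξ) :
    ∀ᵐ ω ∂P, ⨅ n, (min 1 (edist x (ξ n ω)) - min 1 (edist x (χ ω))) = 0 := by
  have hmeas : ∀ ξ ∈ Ξ, Measurable[H] fun ω => min 1 (edist x (ξ ω)) := fun ξ h =>
    (measurable_const.min measurable_edist_right).comp (hm ξ h)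
  have hmeas' : ∀ ξ ∈ Ξ, Measurable fun ω => min 1 (edist x (ξ ω)) := fun ξ h =>
    (hmeas ξ h).mono hH le_rfl
  have hbound : ∀ n, ∫⁻ ω, (min 1 (edist x (ξ n ω)) - min 1 (edist x (χ ω))) ∂P ≤
      ((n : ℝ≥0∞) + 1)⁻¹ := by
    intro n
    let S : Set Ω := {ω | min 1 (edist x (χ ω)) < min 1 (edist x (ξ n ω))}
    have hS : MeasurableSet[H] S := measurableSet_lt (hmeas _ hχ) (hmeas _ (hξ n))
    classical
    let κ : Ω → ℕ := fun ω => if ω ∈ S then 0 else 1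
    have hκ : Measurable[H] κ := Measurable.ite hS measurable_const measurable_const
    obtain ⟨τ, hτ, hτeq⟩ := hd (fun i => if i = 0 then χ else ξ n) _
      (fun i => by split_ifs; exacts [hχ, hξ n]) (isMeasurablePartition_fiber hκ)
    have hτmin : ∀ᵐ ω ∂P, min 1 (edist x (τ ω)) =
        min (min 1 (edist x (χ ω))) (min 1 (edist x (ξ n ω))) := by
      filter_upwards [hτeq] with ω h
      by_cases hω : ω ∈ S
      · rw [h 0 (if_pos hω), if_pos rfl]
        exact (min_eq_left (le_of_lt hω)).symm
      · rw [h 1 (if_neg hω), if_neg one_ne_zero]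
        exact (min_eq_right (not_lt.1 hω)).symm
    have hle : (⨅ χ ∈ Ξ, ∫⁻ ω, min 1 (edist x (χ ω)) ∂P) ≤
        ∫⁻ ω, min (min 1 (edist x (χ ω))) (min 1 (edist x (ξ n ω))) ∂P :=
      (iInf₂_le τ hτ).trans (lintegral_congr_ae hτmin).le
    have hsplit : ∫⁻ ω, min 1 (edist x (ξ n ω)) ∂P =
        ∫⁻ ω, min (min 1 (edist x (χ ω))) (min 1 (edist x (ξ n ω))) ∂P +
          ∫⁻ ω, (min 1 (edist x (ξ n ω)) - min 1 (edist x (χ ω))) ∂P := by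
      rw [← lintegral_add_left ((hmeas' _ hχ).min (hmeas' _ (hξ n)))]
      refine lintegral_congr fun ω => ?_
      rw [min_comm (min 1 (edist x (χ ω))), add_comm, tsub_add_min]
    -- Truncating distances at 1 keeps this integral finite, so it can be cancelled from the
    -- inequality.
    have hfin : ∫⁻ ω, min (min 1 (edist x (χ ω))) (min 1 (edist x (ξ n ω))) ∂P ≠ ⊤ := by
      refine ((lintegral_mono fun ω => (min_le_left _ _).trans (min_le_left _ _)).trans_lt
        (b := ∫⁻ _, 1 ∂P) ?_).ne
      simp
    have h1 := hlt n
    rw [hsplit] at h1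
    exact (ENNReal.add_le_add_iff_left hfin).1 (h1.trans (by gcongr))
  have hzero : ∫⁻ ω, ⨅ n, (min 1 (edist x (ξ n ω)) - min 1 (edist x (χ ω))) ∂P = 0 := by
    refine le_antisymm (ENNReal.le_of_forall_pos_le_add fun ε hε _ => ?_) zero_le
    obtain ⟨n, hn⟩ := ENNReal.exists_inv_nat_lt (ENNReal.coe_pos.2 hε).ne'
    rw [zero_add]
    refine (lintegral_mono fun ω => iInf_le _ n).trans ((hbound n).trans (le_trans ?_ hn.le))
    exact ENNReal.inv_le_inv.2 le_self_add
  exact (lintegral_eq_zero_iff (.iInf fun n => (hmeas' _ (hξ n)).sub (hmeas' _ hχ))).1 hzero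

/-- A decomposable family has a countable subfamily that is pointwise dense in it. -/
theorem IsDecomposable.exists_countable_dense [SecondCountableTopology 𝕏] [BorelSpace 𝕏]
    (hH : H ≤ mF) {Ξ : Set (Ω → 𝕏)}
    (hm : ∀ ξ ∈ Ξ, Measurable[H] ξ) (hd : IsDecomposable H P Ξ) (hne : Ξ.Nonempty) :
    ∃ ξ : ℕ → Ω → 𝕏, (∀ n, ξ n ∈ Ξ) ∧
      ∀ χ ∈ Ξ, ∀ᵐ ω ∂P, χ ω ∈ closure (Set.range fun n => ξ n ω) := by
  let x := TopologicalSpace.denseSeq 𝕏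
  have hex : ∀ k n : ℕ, ∃ ξ ∈ Ξ, ∫⁻ ω, min 1 (edist (x k) (ξ ω)) ∂P ≤
      (⨅ χ ∈ Ξ, ∫⁻ ω, min 1 (edist (x k) (χ ω)) ∂P) + ((n : ℝ≥0∞) + 1)⁻¹ := by
    intro k n
    have hfin : (⨅ χ ∈ Ξ, ∫⁻ ω, min 1 (edist (x k) (χ ω)) ∂P) ≠ ⊤ := by
      obtain ⟨χ, hχ⟩ := hne
      refine ((iInf₂_le χ hχ).trans_lt ((lintegral_mono fun ω => min_le_left _ _).trans_lt
        (b := ∫⁻ _, 1 ∂P) ?_)).ne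
      simp
    have hlt := ENNReal.lt_add_right hfin (b := ((n : ℝ≥0∞) + 1)⁻¹) (by simp)
    simp only [iInf_lt_iff] at hlt
    obtain ⟨ξ, hξ, h⟩ := hlt
    exact ⟨ξ, hξ, h.le⟩
  choose ξ hξ hξle using hex
  refine ⟨fun n => ξ n.unpair.1 n.unpair.2, fun n => hξ _ _, fun χ hχ => ?_⟩
  filter_upwards [ae_all_iff.2 fun k => hd.ae_iInf_tsub_eq_zero hH hm (x k) (hξ k) (hξle k) hχ]
    with ω h
  refine EMetric.mem_closure_iff.2 fun ε hε => ?_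
  -- The bound ε/3 serves the triangle inequality. The bound 1/3 ensures `δ + δ ≤ 1`, so a truncated
  -- distance below `δ + δ` is the true distance.
  let δ : ℝ≥0∞ := min (ε / 3) (1 / 3)
  have hδ : 0 < δ := lt_min (ENNReal.div_pos hε.ne' (by simp)) (ENNReal.div_pos one_ne_zero (by simp))
  have h3 : δ + δ + δ ≤ ε := by
    calc δ + δ + δ ≤ ε / 3 + ε / 3 + ε / 3 := by gcongr <;> exact min_le_left _ _
      _ = ε := ENNReal.add_thirds ε
  have h2 : δ + δ ≤ 1 := by
    calc δ + δ ≤ 1 / 3 + 1 / 3 := by gcongr <;> exact min_le_right _ _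
      _ ≤ 1 / 3 + 1 / 3 + 1 / 3 := le_self_add
      _ = 1 := ENNReal.add_thirds 1
  obtain ⟨_, hk, k, rfl⟩ :=
    EMetric.mem_closure_iff.1 (TopologicalSpace.denseRange_denseSeq 𝕏 (χ ω)) δ hδ |>.imp
      fun _ h => And.symm h
  have hn : ⨅ n, (min 1 (edist (x k) (ξ k n ω)) - min 1 (edist (x k) (χ ω))) < δ := by
    rw [h k]
    exact hδ
  obtain ⟨n, hn⟩ := iInf_lt_iff.1 hn
  have hlt : min 1 (edist (x k) (ξ k n ω)) < δ + δ := by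
    calc min 1 (edist (x k) (ξ k n ω))
        ≤ (min 1 (edist (x k) (ξ k n ω)) - min 1 (edist (x k) (χ ω))) +
          min 1 (edist (x k) (χ ω)) := le_tsub_add
      _ < δ + δ := by
        refine ENNReal.add_lt_add hn ((min_le_right _ _).trans_lt ?_)
        rw [edist_comm]
        exact hk
  have hlt' : edist (x k) (ξ k n ω) < δ + δ := by
    rcases min_lt_iff.1 hlt with h1 | h1
    · exact absurd h1 (not_lt.2 h2)
    · exact h1
  refine ⟨_, ⟨Nat.pair k n, rfl⟩, ?_⟩
  simp only [Nat.unpair_pair]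
  calc edist (χ ω) (ξ k n ω) ≤ edist (χ ω) (x k) + edist (x k) (ξ k n ω) := edist_triangle _ _ _
    _ < δ + (δ + δ) := ENNReal.add_lt_add hk hlt'
    _ = δ + δ + δ := (add_assoc _ _ _).symm
    _ ≤ ε := h3

/-- The `L⁰`-closure of a decomposable family is the family of selections of a random closed
set. -/
theorem IsDecomposable.exists_isRandomClosedSet [SecondCountableTopology 𝕏] [BorelSpace 𝕏]
    (hH : H ≤ mF) {Ξ : Set (Ω → 𝕏)}
    (hm : ∀ ξ ∈ Ξ, Measurable[H] ξ) (hd : IsDecomposable H P Ξ) (hne : Ξ.Nonempty) :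
    ∃ Y : Ω → Set 𝕏, IsRandomClosedSet H P Y ∧ selections H P Y = closureL0 H P Ξ := by
  obtain ⟨ξ, hξ, hdense⟩ := hd.exists_countable_dense hH hm hne
  refine ⟨fun ω => closure (Set.range fun n => ξ n ω),
    ⟨measurableSet_closure_graph fun n => hm _ (hξ n), Eventually.of_forall fun _ =>
      isClosed_closure⟩, Set.Subset.antisymm ?_ ?_⟩
  · rintro η ⟨hη, hηY⟩
    refine ⟨hη, ?_⟩
    -- The first member of the dense sequence within 1/(m + 1) of `η` is glued along the
    -- `H`-measurable fibres of its index.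
    have hex : ∀ m : ℕ, ∃ χ ∈ Ξ, ∀ᵐ ω ∂P, dist (χ ω) (η ω) < 1 / ((m : ℝ) + 1) := by
      intro m
      have hκ : Measurable[H] fun ω => sInf {n | dist (η ω) (ξ n ω) < 1 / ((m : ℝ) + 1)} :=
        @measurable_sInf_nat _ H _ fun n =>
          measurableSet_dist_lt hη (hm _ (hξ n)) _
      obtain ⟨χ, hχ, hχeq⟩ := hd ξ _ hξ (isMeasurablePartition_fiber hκ)
      refine ⟨χ, hχ, ?_⟩
      filter_upwards [hηY, hχeq] with ω h1 h2
      rw [h2 _ rfl, dist_comm]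
      exact Nat.sInf_mem (s := {n | dist (η ω) (ξ n ω) < 1 / ((m : ℝ) + 1)})
        (Metric.mem_closure_range_iff.1 h1 _ (by positivity))
    choose s hs hsd using hex
    refine ⟨s, hs, tendstoInMeasure_of_tendsto_ae
      (fun n => ((hm _ (hs n)).mono hH le_rfl).aestronglyMeasurable) ?_⟩
    filter_upwards [ae_all_iff.2 hsd] with ω h
    rw [tendsto_iff_dist_tendsto_zero]
    exact squeeze_zero (fun _ => dist_nonneg) (fun n => (h n).le)
      (tendsto_one_div_add_atTop_nhds_zero_nat (𝕜 := ℝ))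
  · rintro η ⟨hη, s, hs, hlim⟩
    refine ⟨hη, ?_⟩
    obtain ⟨φ, -, hφ⟩ := hlim.exists_seq_tendsto_ae
    filter_upwards [hφ, ae_all_iff.2 fun n => hdense _ (hs n)] with ω h1 h2
    exact isClosed_closure.mem_of_tendsto h1 (Eventually.of_forall fun n => h2 _)

end

section

variable {Ω 𝕏 : Type*} {H mF : MeasurableSpace Ω} {P : Measure[mF] Ω} {X : Ω → Set 𝕏}
  [NormedAddCommGroup 𝕏] [NormedSpace ℝ 𝕏] [CompleteSpace 𝕏] [MeasurableSpace 𝕏]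

/-- The selections themselves are glued first, which preserves conditional integrability. Locality
of the conditional expectation then identifies the result on each piece. -/
theorem isDecomposable_genCondExp_image (hH : H ≤ mF) :
    IsDecomposable H P (genCondExp H P '' condIntegrableSelections H P X) := by
  intro s B hs hB
  choose ξ hξ hξs using hs
  have hκ : ∀ ω, ∃ n, ω ∈ B n := hB.exists_mem
  choose κ hκ using hκ
  let χ : Ω → 𝕏 := fun ω => ξ (κ ω) ω
  have hχ : ∀ n, ∀ ω ∈ B n, χ ω = ξ n ω := fun n ω hω => by
    simp only [χ, hB.eq_of_mem (hκ ω) hω]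
  have hint : CondIntegrable H P χ := condIntegrable_of_partition hH hB (fun n => (hξ n).2) hχ
  refine ⟨_, ⟨χ, ⟨⟨hint.1, ?_⟩, hint⟩, rfl⟩, ?_⟩
  · filter_upwards [ae_all_iff.2 fun n => (hξ n).1.2] with ω h
    exact h _
  · refine ae_all_iff.2 fun n => ?_
    filter_upwards [genCondExp_eq_on hH hint (hξ n).2 (hB.1 n) (hχ n)] with ω h hω
    rw [h hω, hξs n]

end

/-! ### Support functions -/

theorem le_supportFun {𝕏 : Type*} [NormedAddCommGroup 𝕏] [NormedSpace ℝ 𝕏] {A : Set 𝕏} {x : 𝕏}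
    (hx : x ∈ A) (u : StrongDual ℝ 𝕏) : ((u x : ℝ) : EReal) ≤ supportFun A u :=
  le_iSup₂ (f := fun (x : 𝕏) (_ : x ∈ A) => ((u x : ℝ) : EReal)) x hx

theorem supportFun_le_iSup {𝕏 : Type*} [NormedAddCommGroup 𝕏] [NormedSpace ℝ 𝕏] {A : Set 𝕏}
    {x : ℕ → 𝕏} (hA : A ⊆ closure (Set.range x)) (u : StrongDual ℝ 𝕏) :
    supportFun A u ≤ ⨆ n, ((u (x n) : ℝ) : EReal) := by
  refine iSup₂_le fun y hy => ?_
  have hcl : IsClosed {y : 𝕏 | ((u y : ℝ) : EReal) ≤ ⨆ n, ((u (x n) : ℝ) : EReal)} :=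
    isClosed_le (continuous_coe_real_ereal.comp u.continuous) continuous_const
  refine hcl.closure_subset_iff.2 ?_ (hA hy)
  rintro _ ⟨n, rfl⟩
  exact le_iSup (fun n => ((u (x n) : ℝ) : EReal)) n

section

variable {Ω 𝕏 : Type*} [NormedAddCommGroup 𝕏] [NormedSpace ℝ 𝕏] {ζ : Ω → StrongDual ℝ 𝕏}

open scoped Classical in
/-- The running maximisers of `ζ` along the sequence `ξ`. -/
noncomputable def runningMaximiser (ζ : Ω → StrongDual ℝ 𝕏) (ξ : ℕ → Ω → 𝕏) : ℕ → Ω → 𝕏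
  | 0 => ξ 0
  | n + 1 => {ω | ζ ω (ξ (n + 1) ω) ≤ ζ ω (runningMaximiser ζ ξ n ω)}.piecewise
      (runningMaximiser ζ ξ n) (ξ (n + 1))

theorem apply_runningMaximiser_succ (ξ : ℕ → Ω → 𝕏) (n : ℕ) (ω : Ω) :
    ζ ω (runningMaximiser ζ ξ (n + 1) ω) =
      max (ζ ω (runningMaximiser ζ ξ n ω)) (ζ ω (ξ (n + 1) ω)) := by
  classical
  rw [runningMaximiser]
  by_cases h : ω ∈ {ω | ζ ω (ξ (n + 1) ω) ≤ ζ ω (runningMaximiser ζ ξ n ω)}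
  · rw [Set.piecewise_eq_of_mem _ _ _ h]
    exact (max_eq_left h).symm
  · rw [Set.piecewise_eq_of_notMem _ _ _ h, max_eq_right (le_of_not_ge h)]

end

/-! ### Integrable selections and the identity for support functions -/

section

variable {Ω 𝕏 : Type*} {H mF : MeasurableSpace Ω} {P : Measure[mF] Ω} {X Y : Ω → Set 𝕏}

theorem measurableSet_apply_mem {m : MeasurableSpace Ω} [MeasurableSpace 𝕏]
    (hY : MeasurableSet {p : Ω × 𝕏 | p.2 ∈ Y p.1}) {y : Ω → 𝕏} (hy : Measurable y) :
    MeasurableSet {ω | y ω ∈ Y ω} :=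
  (measurable_id.prodMk hy) hY

variable [NormedAddCommGroup 𝕏] [MeasurableSpace 𝕏]

theorem piecewise_mem_condIntegrableSelections (hH : H ≤ mF) {ξ ξ' : Ω → 𝕏}
    (hξ : ξ ∈ condIntegrableSelections H P X) (hξ' : ξ' ∈ condIntegrableSelections H P X)
    {S : Set Ω} [DecidablePred (· ∈ S)] (hS : MeasurableSet S) :
    S.piecewise ξ ξ' ∈ condIntegrableSelections H P X := by
  have h := hξ.2.piecewise hH hξ'.2 hS
  refine ⟨⟨h.1, ?_⟩, h⟩
  filter_upwards [hξ.1.2, hξ'.1.2] with ω h1 h2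
  by_cases hω : ω ∈ S
  · rwa [Set.piecewise_eq_of_mem _ _ _ hω]
  · rwa [Set.piecewise_eq_of_notMem _ _ _ hω]

theorem runningMaximiser_mem [NormedSpace ℝ 𝕏] [TopologicalSpace.SeparableSpace 𝕏]
    [BorelSpace 𝕏] {ζ : Ω → StrongDual ℝ 𝕏} (hH : H ≤ mF) (hζ : IsRandomDual H ζ) {ξ : ℕ → Ω → 𝕏}
    (hξ : ∀ n, ξ n ∈ condIntegrableSelections H P X) (n : ℕ) :
    runningMaximiser ζ ξ n ∈ condIntegrableSelections H P X := by
  induction n with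
  | zero => exact hξ 0
  | succ n ih =>
    rw [runningMaximiser]
    exact piecewise_mem_condIntegrableSelections hH ih (hξ _)
      (measurableSet_le ((hζ.mono hH).measurable_apply (hξ _).1.1)
        ((hζ.mono hH).measurable_apply ih.1.1))

theorem condIntegrable_of_integrable {ξ : Ω → 𝕏} (hm : Measurable ξ) (hξ : Integrable ξ P) :
    CondIntegrable H P ξ := by
  have hA := isMeasurablePartition_fiber (H := H) (κ := fun _ : Ω => 0) measurable_const
  refine ⟨hm, _, hA, fun n => ?_⟩
  by_cases hn : 0 = n
  · simpa [hn] using hξ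
  · simp [hn]

variable [IsProbabilityMeasure P]
  [CompleteSpace 𝕏] [TopologicalSpace.SeparableSpace 𝕏] [BorelSpace 𝕏]

/-- The Castaing representation of a random closed set by `H`-conditionally integrable
selections. -/
theorem exists_condIntegrableSelections_dense (hH : H ≤ mF) (hX : IsRandomClosedSet mF P X)
    (hsel : (condIntegrableSelections H P X).Nonempty) :
    ∃ ξ : ℕ → Ω → 𝕏, (∀ n, ξ n ∈ condIntegrableSelections H P X) ∧
      ∀ᵐ ω ∂P, X ω ⊆ closure (Set.range fun n => ξ n ω) := by
  classical
  have : SecondCountableTopology 𝕏 := UniformSpace.secondCountable_of_separable 𝕏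
  obtain ⟨ξ₀, hξ₀⟩ := hsel
  have hne : ∀ᵐ ω ∂P, (X ω).Nonempty := by
    filter_upwards [hξ₀.1.2] with ω h
    exact ⟨_, h⟩
  obtain ⟨η, hη, hηX⟩ := exists_castaing P hX.measurableSet_graph hne
  -- The selection `η n` need not be conditionally integrable, so it is kept only where its norm is
  -- at most `m` and replaced by `ξ₀` elsewhere. Letting `m` grow recovers every value of `η n`.
  let S : ℕ → ℕ → Set Ω := fun n m => {ω | ‖η n ω‖ ≤ m}
  have hS : ∀ n m, MeasurableSet (S n m) := fun n m =>
    measurableSet_le (hη n).norm measurable_const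
  have hmem : ∀ n m, (S n m).piecewise (η n) ξ₀ ∈ condIntegrableSelections H P X := by
    intro n m
    have hint : Integrable ((S n m).indicator (η n)) P := by
      refine (integrable_const (m : ℝ)).mono'
        ((hη n).indicator (hS n m)).aestronglyMeasurable (Eventually.of_forall fun ω => ?_)
      by_cases hω : ω ∈ S n m
      · rw [Set.indicator_of_mem hω]
        exact hω
      · rw [Set.indicator_of_notMem hω, norm_zero]
        positivity
    have e : (S n m).piecewise (η n) ξ₀ = (S n m).piecewise ((S n m).indicator (η n)) ξ₀ := by
      ext ω
      by_cases hω : ω ∈ S n m <;> simp [hω]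
    have h : CondIntegrable H P ((S n m).piecewise (η n) ξ₀) := by
      rw [e]
      exact (condIntegrable_of_integrable ((hη n).indicator (hS n m)) hint).piecewise hH hξ₀.2
        (hS n m)
    refine ⟨⟨h.1, ?_⟩, h⟩
    filter_upwards [hηX, hX.ae_isClosed, hξ₀.1.2] with ω h1 h2 h3
    by_cases hω : ω ∈ S n m
    · rw [Set.piecewise_eq_of_mem _ _ _ hω, ← h2.closure_eq]
      exact h1.1 n
    · rwa [Set.piecewise_eq_of_notMem _ _ _ hω]
  refine ⟨fun n => (S n.unpair.1 n.unpair.2).piecewise (η n.unpair.1) ξ₀,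
    fun n => hmem _ _, ?_⟩
  filter_upwards [hηX] with ω h
  refine h.2.trans (closure_mono ?_)
  rintro _ ⟨n, rfl⟩
  obtain ⟨m, hm⟩ := exists_nat_ge ‖η n ω‖
  refine ⟨Nat.pair n m, ?_⟩
  simp only [Nat.unpair_pair]
  exact Set.piecewise_eq_of_mem (S n m) _ _ hm

variable [NormedSpace ℝ 𝕏] {ζ : Ω → StrongDual ℝ 𝕏}

/-- The generalised conditional expectation of `⟨ζ, ξ⟩` is `⟨ζ, E(ξ | H)⟩`. -/
theorem exists_partition_condExp_dual_apply (hH : H ≤ mF) (hζ : IsRandomDual H ζ) {ξ : Ω → 𝕏}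
    (hξ : CondIntegrable H P ξ) :
    ∃ B : ℕ → Set Ω, IsMeasurablePartition H B ∧
      (∀ i, Integrable ((B i).indicator fun ω => ζ ω (ξ ω)) P) ∧
      ∀ i, ∀ᵐ ω ∂P, ω ∈ B i →
        ζ ω (genCondExp H P ξ ω) = (P[(B i).indicator fun ω => ζ ω (ξ ω)|H]) ω := by
  classical
  obtain ⟨-, A, hA, hAi⟩ := id hξ
  -- Refining by the integer part of the norm makes `ζ` bounded on each piece, where the bounded
  -- pull-out property applies.
  have hκ : Measurable[H] fun ω => ⌊‖ζ ω‖⌋₊ := Nat.measurable_floor.comp hζ.measurable_norm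
  have hB := hA.inter (isMeasurablePartition_fiber hκ)
  refine ⟨_, hB, ?_⟩
  rw [← forall_and]
  intro i
  set B : Set Ω := A i.unpair.1 ∩ {ω | ⌊‖ζ ω‖⌋₊ = i.unpair.2} with hBdef
  have hBm : MeasurableSet[H] B := hB.1 i
  let ζ' : Ω → StrongDual ℝ 𝕏 := B.indicator ζ
  have hζ' : IsRandomDual H ζ' := by
    intro x
    have e : (fun ω => ζ' ω x) = B.indicator fun ω => ζ ω x := by
      ext ω
      by_cases hω : ω ∈ B <;> simp [ζ', hω]
    rw [e]
    exact (hζ x).indicator hBm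
  have hbound : ∀ ω, ‖ζ' ω‖ ≤ (i.unpair.2 : ℝ) + 1 := by
    intro ω
    by_cases hω : ω ∈ B
    · simp only [ζ', Set.indicator_of_mem hω]
      have h1 := Nat.lt_floor_add_one ‖ζ ω‖
      rw [show ⌊‖ζ ω‖⌋₊ = i.unpair.2 from hω.2] at h1
      exact h1.le
    · simp only [ζ', Set.indicator_of_notMem hω, norm_zero]
      positivity
  have hint : Integrable (B.indicator ξ) P := by
    rw [hBdef, Set.inter_comm, ← Set.indicator_indicator]
    exact (hAi _).indicator (hH _ ((isMeasurablePartition_fiber hκ).1 _))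
  have e : (B.indicator fun ω => ζ ω (ξ ω)) = fun ω => ζ' ω (B.indicator ξ ω) := by
    ext ω
    by_cases hω : ω ∈ B <;> simp [ζ', hω]
  rw [e]
  refine ⟨integrable_dual_apply hH hζ' hbound hint, ?_⟩
  filter_upwards [condExp_dual_apply hH hζ' hbound hint, indicator_genCondExp hξ hBm hint]
    with ω h1 h2 hω
  rw [h1, ← h2, Set.indicator_of_mem hω]
  simp only [ζ', Set.indicator_of_mem hω]

theorem genCondExpE_eq_dual_apply_add (hH : H ≤ mF) (hζ : IsRandomDual H ζ) {ξ : Ω → 𝕏}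
    (hξ : CondIntegrable H P ξ) {h : Ω → EReal} (hh : Measurable h)
    (hle : ∀ᵐ ω ∂P, ((ζ ω (ξ ω) : ℝ) : EReal) ≤ h ω) :
    HasGenCondExpE H P h ∧ genCondExpE H P h =ᵐ[P] fun ω =>
      ((ζ ω (genCondExp H P ξ ω) : ℝ) : EReal) +
        ((P⁻[fun ω => (h ω - ((ζ ω (ξ ω) : ℝ) : EReal)).toENNReal|H]) ω : EReal) := by
  obtain ⟨B, hB, hint, hγ⟩ := exists_partition_condExp_dual_apply hH hζ hξ
  exact genCondExpE_eq_add hH hB ((hζ.mono hH).measurable_apply hξ.1) hint hγ hh hle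

theorem dual_genCondExp_le_genCondExpE (hH : H ≤ mF) (hζ : IsRandomDual H ζ) {ξ : Ω → 𝕏}
    (hξ : CondIntegrable H P ξ) {h : Ω → EReal} (hh : Measurable h)
    (hle : ∀ᵐ ω ∂P, ((ζ ω (ξ ω) : ℝ) : EReal) ≤ h ω) :
    ∀ᵐ ω ∂P, ((ζ ω (genCondExp H P ξ ω) : ℝ) : EReal) ≤ genCondExpE H P h ω := by
  filter_upwards [(genCondExpE_eq_dual_apply_add hH hζ hξ hh hle).2] with ω h1
  rw [h1]
  exact le_add_of_nonneg_right (EReal.coe_ennreal_nonneg _)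

/-- Monotone convergence for generalised conditional expectations. -/
theorem genCondExpE_le_of_iSup (hH : H ≤ mF) (hζ : IsRandomDual H ζ) {χ : ℕ → Ω → 𝕏}
    (hχ : ∀ n, CondIntegrable H P (χ n)) (hmono : ∀ ω, Monotone fun n => ζ ω (χ n ω))
    {h c : Ω → EReal} (hh : Measurable h)
    (heq : h =ᵐ[P] fun ω => ⨆ n, ((ζ ω (χ n ω) : ℝ) : EReal))
    (hc : ∀ n, ∀ᵐ ω ∂P, ((ζ ω (genCondExp H P (χ n) ω) : ℝ) : EReal) ≤ c ω) :
    ∀ᵐ ω ∂P, genCondExpE H P h ω ≤ c ω := by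
  have hmeas : ∀ n, Measurable fun ω => ζ ω (χ n ω) := fun n =>
    (hζ.mono hH).measurable_apply (hχ n).1
  -- Subtracting the first term makes the increasing sequence nonnegative, so monotone convergence
  -- needs no integrability of the limit.
  let k : ℕ → Ω → ℝ≥0∞ := fun n ω => ENNReal.ofReal (ζ ω (χ n ω) - ζ ω (χ 0 ω))
  have hk : ∀ n, Measurable (k n) := fun n => ((hmeas n).sub (hmeas 0)).ennreal_ofReal
  have hkmono : Monotone k := fun m n hmn ω =>
    ENNReal.ofReal_le_ofReal (sub_le_sub_right (hmono ω hmn) _)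
  have hle : ∀ᵐ ω ∂P, ((ζ ω (χ 0 ω) : ℝ) : EReal) ≤ h ω := by
    filter_upwards [heq] with ω h1
    rw [h1]
    exact le_iSup (fun n => ((ζ ω (χ n ω) : ℝ) : EReal)) 0
  -- The expectation of ⟨ζ, χ_n⟩ is computed twice, relative to `χ 0` and relative to `χ n` itself.
  have hstep : ∀ n, ∀ᵐ ω ∂P, ((ζ ω (genCondExp H P (χ 0) ω) : ℝ) : EReal) +
      ((P⁻[k n|H]) ω : EReal) = ((ζ ω (genCondExp H P (χ n) ω) : ℝ) : EReal) := by
    intro n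
    have hm : Measurable fun ω => ((ζ ω (χ n ω) : ℝ) : EReal) := (hmeas n).coe_real_ereal
    have h0 := (genCondExpE_eq_dual_apply_add hH hζ (hχ 0) hm (Eventually.of_forall fun ω =>
      EReal.coe_le_coe_iff.2 (hmono ω n.zero_le))).2
    have hn := (genCondExpE_eq_dual_apply_add hH hζ (hχ n) hm (Eventually.of_forall fun ω =>
      le_rfl)).2
    have e0 : (fun ω => (((ζ ω (χ n ω) : ℝ) : EReal) - ((ζ ω (χ 0 ω) : ℝ) : EReal)).toENNReal) =
        k n := by
      ext ω
      rw [← EReal.coe_sub, EReal.toENNReal_of_ne_top (EReal.coe_ne_top _), EReal.toReal_coe]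
    have en : (fun ω => (((ζ ω (χ n ω) : ℝ) : EReal) - ((ζ ω (χ n ω) : ℝ) : EReal)).toENNReal) =
        (0 : Ω → ℝ≥0∞) := by
      ext ω
      rw [← EReal.coe_sub, sub_self]
      simp
    rw [e0] at h0
    rw [en, condLExp_zero] at hn
    filter_upwards [h0, hn] with ω h1 h2
    rw [← h1, h2]
    simp
  have hsup : P⁻[fun ω => (h ω - ((ζ ω (χ 0 ω) : ℝ) : EReal)).toENNReal|H] ≤ᵐ[P]
      P⁻[fun ω => ⨆ n, k n ω|H] := by
    refine condLExp_mono ?_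
    filter_upwards [heq] with ω h1
    have h2 : h ω - ((ζ ω (χ 0 ω) : ℝ) : EReal) ≤ ((⨆ n, k n ω : ℝ≥0∞) : EReal) := by
      rw [EReal.sub_le_iff_le_add (Or.inl (EReal.coe_ne_bot _)) (Or.inl (EReal.coe_ne_top _)), h1]
      refine iSup_le fun n => ?_
      rw [← EReal.sub_le_iff_le_add (Or.inl (EReal.coe_ne_bot _)) (Or.inl (EReal.coe_ne_top _)),
        ← EReal.coe_sub]
      calc ((ζ ω (χ n ω) - ζ ω (χ 0 ω) : ℝ) : EReal) ≤ ((k n ω : ℝ≥0∞) : EReal) := by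
            rw [EReal.coe_ennreal_ofReal]
            exact EReal.coe_le_coe_iff.2 (le_max_left _ _)
        _ ≤ _ := EReal.coe_ennreal_le_coe_ennreal_iff.2 (le_iSup (fun n => k n ω) n)
    simpa using EReal.toENNReal_le_toENNReal h2
  filter_upwards [(genCondExpE_eq_dual_apply_add hH hζ (hχ 0) hh hle).2, ae_all_iff.2 hstep,
    hsup, condLExp_iSup hH hk hkmono, ae_all_iff.2 hc] with ω h1 h2 h3 h4 h5
  rw [h1, add_comm, ← EReal.le_sub_iff_add_le (Or.inl (EReal.coe_ne_bot _))
    (Or.inl (EReal.coe_ne_top _))]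
  rw [h4] at h3
  have h6 : ∀ n, ((P⁻[k n|H]) ω : EReal) ≤
      c ω - ((ζ ω (genCondExp H P (χ 0) ω) : ℝ) : EReal) := by
    intro n
    rw [EReal.le_sub_iff_add_le (Or.inl (EReal.coe_ne_bot _)) (Or.inl (EReal.coe_ne_top _)),
      add_comm, h2 n]
    exact h5 n
  have h7 : (⨆ n, (P⁻[k n|H]) ω) ≤
      (c ω - ((ζ ω (genCondExp H P (χ 0) ω) : ℝ) : EReal)).toENNReal := by
    refine iSup_le fun n => ?_
    simpa using EReal.toENNReal_le_toENNReal (h6 n)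
  refine (EReal.coe_ennreal_le_coe_ennreal_iff.2 (h3.trans h7)).trans_eq ?_
  exact EReal.coe_toENNReal ((EReal.coe_ennreal_nonneg _).trans (h6 0))

theorem genCondExp_mem_selections (hH : H ≤ mF) (hY : IsGenCondExpSet H P X Y) {ξ : Ω → 𝕏}
    (hξ : ξ ∈ condIntegrableSelections H P X) : genCondExp H P ξ ∈ selections H P Y := by
  rw [hY.selections_eq]
  refine ⟨measurable_genCondExp ξ, fun _ => genCondExp H P ξ, fun _ => ⟨ξ, hξ, rfl⟩, ?_⟩
  exact tendstoInMeasure_of_tendsto_ae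
    (fun _ => ((measurable_genCondExp ξ).mono hH le_rfl).aestronglyMeasurable)
    (Eventually.of_forall fun _ => tendsto_const_nhds)

/-- The Castaing representation of a version of the generalised conditional expectation. -/
theorem IsGenCondExpSet.exists_selections_dense (hH : H ≤ mF) (hY : IsGenCondExpSet H P X Y)
    (hne : (selections H P Y).Nonempty) :
    ∃ η : ℕ → Ω → 𝕏, (∀ n, η n ∈ selections H P Y) ∧
      ∀ᵐ ω ∂P, Y ω ⊆ closure (Set.range fun n => η n ω) := by
  have : SecondCountableTopology 𝕏 := UniformSpace.secondCountable_of_separable 𝕏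
  obtain ⟨y, hy, hyY⟩ := hne
  have hgraph := hY.isRandomClosedSet.measurableSet_graph
  have hmem : MeasurableSet[H] {ω | y ω ∈ Y ω} :=
    measurableSet_apply_mem hgraph hy
  -- The selections must be `H`-measurable, so the Castaing theorem is applied on `H` with the
  -- trimmed measure. The event that `y` lies in `Y` belongs to `H`, hence it has full trimmed
  -- measure.
  have hne' : ∀ᵐ ω ∂(P.trim hH), (Y ω).Nonempty := by
    have h : ∀ᵐ ω ∂(P.trim hH), y ω ∈ Y ω := by
      exact (trim_measurableSet_eq hH (MeasurableSet.compl hmem)).trans hyY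
    filter_upwards [h] with ω hω
    exact ⟨_, hω⟩
  obtain ⟨η, hη, hηY⟩ := @exists_castaing Ω 𝕏 H _ _ _ _ _ _ (P.trim hH) _ Y hgraph hne'
  have hηY' := ae_of_ae_trim hH hηY
  refine ⟨η, fun n => ⟨hη n, ?_⟩, ?_⟩
  · filter_upwards [hηY', hY.isRandomClosedSet.ae_isClosed] with ω h1 h2
    rw [← h2.closure_eq]
    exact h1.1 n
  · filter_upwards [hηY'] with ω h
    exact h.2

/-- The generalised conditional expectation of the support function. -/
theorem IsGenCondExpSet.genCondExpE_supportFun [P.IsComplete] (hH : H ≤ mF)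
    (hX : IsRandomClosedSet mF P X) (hsel : (condIntegrableSelections H P X).Nonempty)
    (hY : IsGenCondExpSet H P X Y) (hζ : IsRandomDual H ζ) :
    HasGenCondExpE H P (fun ω => supportFun (X ω) (ζ ω)) ∧
      genCondExpE H P (fun ω => supportFun (X ω) (ζ ω)) =ᵐ[P]
        fun ω => supportFun (Y ω) (ζ ω) := by
  obtain ⟨ξ, hξ, hξX⟩ := exists_condIntegrableSelections_dense hH hX hsel
  let χ : ℕ → Ω → 𝕏 := runningMaximiser ζ ξ
  have hχ : ∀ n, χ n ∈ condIntegrableSelections H P X := runningMaximiser_mem hH hζ hξ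
  have hmono : ∀ ω, Monotone fun n => ζ ω (χ n ω) := fun ω =>
    monotone_nat_of_le_succ fun n => by
      simp only [χ, apply_runningMaximiser_succ]
      exact le_max_left _ _
  have hξχ : ∀ n ω, ζ ω (ξ n ω) ≤ ζ ω (χ n ω) := by
    intro n ω
    cases n with
    | zero => exact le_rfl
    | succ n =>
      simp only [χ, apply_runningMaximiser_succ]
      exact le_max_right _ _
  have heq : (fun ω => supportFun (X ω) (ζ ω)) =ᵐ[P]
      fun ω => ⨆ n, ((ζ ω (χ n ω) : ℝ) : EReal) := by
    filter_upwards [hξX, ae_all_iff.2 fun n => (hχ n).1.2] with ω h1 h2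
    refine le_antisymm ((supportFun_le_iSup h1 _).trans ?_)
      (iSup_le fun n => le_supportFun (h2 n) _)
    exact iSup_mono fun n => EReal.coe_le_coe_iff.2 (hξχ n ω)
  have hmeas : Measurable fun ω => supportFun (X ω) (ζ ω) := by
    -- The support function is only almost surely equal to a countable supremum; completeness of `P`
    -- turns this into measurability.
    refine Measurable.congr_ae (f := fun ω => ⨆ n, ((ζ ω (χ n ω) : ℝ) : EReal)) ?_ heq.symm
    exact .iSup fun n => ((hζ.mono hH).measurable_apply (hχ n).1.1).coe_real_ereal
  have hdom : ∀ ξ ∈ condIntegrableSelections H P X,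
      ∀ᵐ ω ∂P, ((ζ ω (ξ ω) : ℝ) : EReal) ≤ supportFun (X ω) (ζ ω) := by
    intro ξ hξ
    filter_upwards [hξ.1.2] with ω h
    exact le_supportFun h _
  refine ⟨(genCondExpE_eq_dual_apply_add hH hζ (hχ 0).2 hmeas (hdom _ (hχ 0))).1, ?_⟩
  have hupper : ∀ᵐ ω ∂P, genCondExpE H P (fun ω => supportFun (X ω) (ζ ω)) ω ≤
      supportFun (Y ω) (ζ ω) := by
    refine genCondExpE_le_of_iSup hH hζ (fun n => (hχ n).2) hmono hmeas heq fun n => ?_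
    filter_upwards [(genCondExp_mem_selections hH hY (hχ n)).2] with ω h
    exact le_supportFun h _
  obtain ⟨η, hη, hηY⟩ := hY.exists_selections_dense hH
    ⟨_, genCondExp_mem_selections hH hY (hχ 0)⟩
  have hlower : ∀ n, ∀ᵐ ω ∂P, ((ζ ω (η n ω) : ℝ) : EReal) ≤
      genCondExpE H P (fun ω => supportFun (X ω) (ζ ω)) ω := by
    intro n
    have hηn := hη n
    rw [hY.selections_eq] at hηn
    obtain ⟨-, s, hs, hlim⟩ := hηn
    choose τ hτ hτs using hs
    -- An almost surely convergent subsequence suffices, since each `ζ ω` is continuous and the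
    -- bound does not depend on the index.
    obtain ⟨φ, -, hφ⟩ := hlim.exists_seq_tendsto_ae
    filter_upwards [hφ, ae_all_iff.2 fun j => dual_genCondExp_le_genCondExpE hH hζ (hτ j).2 hmeas
      (hdom _ (hτ j))] with ω h1 h2
    refine le_of_tendsto ((continuous_coe_real_ereal.comp (ζ ω).continuous).continuousAt.tendsto.comp
      h1) (Eventually.of_forall fun j => ?_)
    have := h2 (φ j)
    rw [hτs] at this
    exact this
  filter_upwards [hupper, hηY, ae_all_iff.2 hlower] with ω h1 h2 h3
  exact le_antisymm h1 ((supportFun_le_iSup h2 _).trans (iSup_le h3))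

theorem exists_isGenCondExpSet (hH : H ≤ mF)
    (hsel : (condIntegrableSelections H P X).Nonempty) :
    ∃ Y : Ω → Set 𝕏, IsGenCondExpSet H P X Y := by
  have : SecondCountableTopology 𝕏 := UniformSpace.secondCountable_of_separable 𝕏
  obtain ⟨Y, hY, hsY⟩ := (isDecomposable_genCondExp_image (X := X) (P := P)
    hH).exists_isRandomClosedSet hH
      (by rintro _ ⟨ξ, -, rfl⟩; exact measurable_genCondExp ξ) (hsel.image _)
  exact ⟨Y, hY, hsY⟩

end

end RandomSets

theorem lemma6p5 {Ω 𝕏 : Type*} (H : MeasurableSpace Ω) {mF : MeasurableSpace Ω} (hH : H ≤ mF)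
    (P : Measure[mF] Ω) [IsProbabilityMeasure P] [P.IsComplete]
    [NormedAddCommGroup 𝕏] [NormedSpace ℝ 𝕏] [CompleteSpace 𝕏]
    [TopologicalSpace.SeparableSpace 𝕏] [MeasurableSpace 𝕏] [BorelSpace 𝕏]
    (X : Ω → Set 𝕏) (hX : RandomSets.IsRandomClosedSet mF P X)
    (hsel : (RandomSets.condIntegrableSelections H P X).Nonempty) :
    (∃ Y : Ω → Set 𝕏, RandomSets.IsGenCondExpSet H P X Y) ∧
    ∀ Y : Ω → Set 𝕏, RandomSets.IsGenCondExpSet H P X Y →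
      ∀ ζ : Ω → StrongDual ℝ 𝕏, RandomSets.IsRandomDual H ζ →
        RandomSets.HasGenCondExpE H P (fun ω => RandomSets.supportFun (X ω) (ζ ω)) ∧
        RandomSets.genCondExpE H P (fun ω => RandomSets.supportFun (X ω) (ζ ω))
          =ᵐ[P] fun ω => RandomSets.supportFun (Y ω) (ζ ω) :=
  ⟨RandomSets.exists_isGenCondExpSet hH hsel, fun _ hY _ hζ =>
    hY.genCondExpE_supportFun hH hX hsel hζ⟩
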